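/- **Setting.** Fix a wavelength $\lambda>0$, a distance $d>0$, a length $L>0$ and a noise level $v>0$. Source and destination lie on two parallel lines at distance $d$. A (random, complex) current density $J$ on a part $S\subseteq\mathbb R$ of the source line induces on the destination line the field $E(r)=\int_S g(r-s)J(s)\,\mathrm ds$, where, with $\rho=\sqrt{x^2+d^2}$, $k=2\pi/\lambda$ and $Z_0=120\pi$, $$g(x)=\frac{-\mathrm jZ_0e^{\mathrm jk\rho}}{2\lambda\rho}\Big[\frac{d^2}{\rho^2}+\frac{\mathrm j}{k\rho}\,\frac{d^2-2x^2}{\rho^2}-\frac1{k^2\rho^2}\,\frac{d^2-2x^2}{\rho^2}\Big].$$ A destination $D\subseteq\mathbb R$ receives $Y=E+N$ on $D$, where $N$ is circularly symmetric complex white Gaussian noise with autocorrelation $v\,\delta(r-r')$, independent of $J$. The mutual information $I(J;Y)\in[0,\infty]$ is the supremum of $I\big((\int_S\psi_jJ)_{j\le m};(\langle\varphi_i,E\rangle+N_i)_{i\le n}\big)$ over all finite families $\psi_1,\dots,\psi_m\in L^1(S)\cap L^\infty(S)$ and all finite orthonormal families $\varphi_1,\dots,\varphi_n$ in $L^2(D)$.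 Here $\langle\varphi,E\rangle=\int_D\overline{\varphi}E$, the $N_i$ are the noise coordinates (independent circular complex Gaussians of variance $v$), and the mutual information of two random vectors is the Kullback–Leibler divergence of their joint law from the product of their laws. **Stationarization.** Let $J$ be a measurable complex stochastic process, of arbitrary distribution and not necessarily stationary, with $\mathbb E\int_{-L/2}^{L/2}|J(s)|\,\mathrm ds<\infty$; it is the current density on the source $[-L/2,L/2]$. Let $(J_n)_{n\in\mathbb Z}$ be independent copies of $J$, let $J'(s)=J_n(s-nL)$ for $s\in[-L/2+nL,L/2+nL)$, and let $J''(s)=J'(s+\theta)$ for $s\in\mathbb R$, with $\theta$ uniformly distributed on $[0,L]$ and independent of $(J_n)_n$. **Theorem.** The process $J''$ is strictly stationary, and almost surely the integral $\int_{\mathbb R}g(r-s)J''(s)\,\mathrm ds$ converges absolutely for every $r\in\mathbb R$. Let $I_{L,L}$ be the mutual information between the source $[-L/2,L/2]$ with current density $J$ and a destination of length $L$ (for instance the segment $[-L/2,L/2]$ opposite to the source, but any segment $[b,b+L]$ is allowed). Let $I_{\infty,2L}$ be the mutual information between the infinite source $\mathbb R$ with current density $J''$ and a destination $[a,a+2L]$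 of length $2L$, with $a\in\mathbb R$ arbitrary. Then $$I_{L,L}\le I_{\infty,2L}.$$ -/

import Mathlib

open MeasureTheory ProbabilityTheory
open scoped ENNReal NNReal

noncomputable section

namespace LinearAntenna

/-- Free-space intrinsic impedance (in ohms). -/
def Z₀ : ℝ := 120 * Real.pi

/-- The scalar Green function `g(r, s)` between two parallel lines at distance `d` for the wavelength
`lam`, as a function of `x = r - s`. -/
def green (lam d x : ℝ) : ℂ :=
  let ρ : ℝ := √(x ^ 2 + d ^ 2)
  let k : ℝ := 2 * Real.pi / lam
  (-Complex.I * Z₀ * Complex.exp (Complex.I * (k * ρ : ℝ))) / (2 * lam * ρ : ℝ) *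
    ((d ^ 2 / ρ ^ 2 : ℝ) + Complex.I / (k * ρ : ℝ) * ((d ^ 2 - 2 * x ^ 2) / ρ ^ 2 : ℝ)
      - (1 / (k ^ 2 * ρ ^ 2) * ((d ^ 2 - 2 * x ^ 2) / ρ ^ 2) : ℝ))

/-- The electric field at the point `r` of the destination line that is induced by the current density
`J` on the part `S` of the source line. -/
def efield {Ω : Type*} (lam d : ℝ) (S : Set ℝ) (J : ℝ → Ω → ℂ) (r : ℝ) (ω : Ω) : ℂ :=
  ∫ s in S, green lam d (r - s) * J s ω

/-- The circularly symmetric complex Gaussian distribution with mean `0` and variance `v`. -/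
def complexGaussian (v : ℝ≥0) : Measure ℂ :=
  ((gaussianReal 0 (v / 2)).prod (gaussianReal 0 (v / 2))).map (fun p => (⟨p.1, p.2⟩ : ℂ))

/-- The law of the coordinates of complex white Gaussian noise with autocorrelation `v δ(r - r')`
with respect to `n` orthonormal functions: independent complex Gaussians of variance `v`. -/
def whiteNoise (v : ℝ≥0) (n : ℕ) : Measure (Fin n → ℂ) :=
  Measure.pi fun _ => complexGaussian v

/-- The mutual information `I(X; Y)` (in nats) of two random elements: the Kullback-Leibler divergence
of their joint law from the product of their laws. -/
def mutualInfo {Ω α β : Type*} [MeasurableSpace Ω] [MeasurableSpace α] [MeasurableSpace β]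
    (P : Measure Ω) (X : Ω → α) (Y : Ω → β) : ℝ≥0∞ :=
  InformationTheory.klDiv (P.map fun ω => (X ω, Y ω)) ((P.map X).prod (P.map Y))

/-- The mutual information between the current density `J` on the source `S` and the received field
`Y = E + N` on the destination `D`, where `N` is white Gaussian noise of autocorrelation
`v δ(r - r')`, independent of `J`. It is the supremum, over all finite families of linear functionals
`∫ ψ J` of the current and all finite orthonormal families `φ` in `L²(D)`, of the mutual information
between the numbers `∫ ψ_j J` and the noisy coordinates `⟨φ_i, Y⟩ = ⟨φ_i, E⟩ + ⟨φ_i, N⟩`. -/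
def fieldInfo {Ω : Type*} [MeasurableSpace Ω] (P : Measure Ω) (lam d : ℝ) (v : ℝ≥0)
    (J : ℝ → Ω → ℂ) (S D : Set ℝ) : ℝ≥0∞ :=
  ⨆ (m : ℕ) (ψ : Fin m → ℝ → ℂ)
    (_ : ∀ j, MemLp (ψ j) 1 (volume.restrict S) ∧ MemLp (ψ j) ∞ (volume.restrict S))
    (n : ℕ) (φ : Fin n → Lp ℂ 2 (volume.restrict D)) (_ : Orthonormal ℂ φ),
    mutualInfo (P.prod (whiteNoise v n))
      (fun p j => ∫ s in S, ψ j s * J s p.1)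
      (fun p i => (∫ r in D, star (φ i r) * efield lam d S J r p.1) + p.2 i)

/-- The periodic process `J'` on the whole line: independent copies of the current density `J` on
`[-L/2, L/2)` are placed in the cells `[-L/2 + n L, L/2 + n L)`; the copy in the `n`-th cell is
driven by the coordinate `ω n`. -/
def periodicCopy {Ω : Type*} (L : ℝ) (J : ℝ → Ω → ℂ) (s : ℝ) (ω : ℤ → Ω) : ℂ :=
  J (s - ⌊s / L + 1 / 2⌋ * L) (ω ⌊s / L + 1 / 2⌋)

/-- The randomly shifted process `J''(s) = J'(s + θ)`. -/
def stationarized {Ω : Type*} (L : ℝ) (J : ℝ → Ω → ℂ) (s : ℝ) (p : (ℤ → Ω) × ℝ) : ℂ :=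
  periodicCopy L J (s + p.2) p.1

/-- The probability measure behind `J''`: independent copies of `P`, and independently of them a shift
`θ` that is uniformly distributed on `[0, L]`. -/
def stationarizedMeasure {Ω : Type*} [MeasurableSpace Ω] (L : ℝ) (P : Measure Ω) :
    Measure ((ℤ → Ω) × ℝ) :=
  (Measure.infinitePi fun _ : ℤ => P).prod (ProbabilityTheory.cond volume (Set.Icc 0 L))

/-- Strict stationarity: the finite-dimensional distributions are invariant under translations. -/
def StrictlyStationary {Ω : Type*} [MeasurableSpace Ω] (P : Measure Ω) (J : ℝ → Ω → ℂ) : Prop :=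
  ∀ (τ : ℝ) (n : ℕ) (s : Fin n → ℝ),
    P.map (fun ω i => J (s i + τ) ω) = P.map (fun ω i => J (s i) ω)

end LinearAntenna

end

/-! Write `gaussInfo` for the information between all the underlying randomness and a finite signal
received in white noise. Up to affine constants that depend on the noise only, it is the
differential entropy of the output (`gaussInfo_add_noiseMean`). Hence it depends on the law of the
signal only and ignores deterministic offsets; by Fatou it is lower semicontinuous under almost sure
convergence (`eventually_lt_gaussInfo`); by Jensen it is at least any lower bound that holds after
fixing an independent part of the randomness (`le_gaussInfo_prod`), the analogue of I(T,X;Y) ≥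
I(X;Y|T).

Fix finitely many test functions on `[b, b + L]`. Surrounding the source by independent copies
cannot decrease the information: once the other cells are fixed, they add a constant
(`gaussInfo_segmentSignal_le`). The resulting information, as a function of the shift `x` of the
periodic process, is `L`-periodic and lower semicontinuous, so any `c` below its value at `0` is
also exceeded for `|x| < δ`.

A destination of length `2L` has slack `L`: whatever `θ` is, some translate of `[b, b + L]` inside
it sees the periodic process at phase `0` modulo `L`. The receiver does not know `θ`, and only
finitely many test functions are allowed. So the slack is discretized into `K + 1` translates with
phases `L / K < δ` apart, and the receiver observes an orthonormal basis of the span of all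
translated test functions. For every `θ`, one of the translates has phase within `δ`. Its
coordinates come from the observed ones by a matrix with orthonormal rows, which keeps the noise
white, so the observation carries at least `c`; averaging over `θ` preserves this bound.

Finally, the information about `θ` and all the copies is information about the noiseless signal
itself (`mutualInfo_self_eq_gaussInfo`), which is an admissible functional of `J''`
(`Tame.integral_adjointKernel_mul`). -/

noncomputable section

namespace LinearAntenna

/-! ### Density and mean energy of white Gaussian noise. -/

section Noise

lemma norm_mk_sq (x y : ℝ) : ‖(⟨x, y⟩ : ℂ)‖ ^ 2 = x ^ 2 + y ^ 2 := by
  rw [← Complex.normSq_eq_norm_sq, Complex.normSq_mk]; ring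

/-- The exponent of the density of white Gaussian noise. -/
def noiseEnergy (v : ℝ≥0) {n : ℕ} (z : Fin n → ℂ) : ℝ := ∑ i, ‖z i‖ ^ 2 / (v : ℝ)

lemma noiseEnergy_nonneg (v : ℝ≥0) {n : ℕ} (z : Fin n → ℂ) : 0 ≤ noiseEnergy v z :=
  Finset.sum_nonneg fun _ _ => by positivity

@[fun_prop]
lemma continuous_noiseEnergy (v : ℝ≥0) (n : ℕ) :
    Continuous (noiseEnergy v : (Fin n → ℂ) → ℝ) := by
  unfold noiseEnergy; fun_prop

/-- The maximum of the density of white Gaussian noise. -/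
def noisePeak (v : ℝ≥0) (n : ℕ) : ℝ := ((Real.pi * v)⁻¹) ^ n

lemma noisePeak_pos {v : ℝ≥0} (hv : 0 < v) (n : ℕ) : 0 < noisePeak v n := by
  have : (0 : ℝ) < v := hv
  unfold noisePeak; positivity

instance isProbabilityMeasure_complexGaussian (v : ℝ≥0) :
    IsProbabilityMeasure (complexGaussian v) :=
  Measure.isProbabilityMeasure_map (Complex.measurableEquivRealProd.symm.measurable).aemeasurable

instance isProbabilityMeasure_whiteNoise (v : ℝ≥0) (n : ℕ) :
    IsProbabilityMeasure (whiteNoise v n) := by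
  unfold whiteNoise; infer_instance

lemma complexGaussian_eq_withDensity {v : ℝ≥0} (hv : 0 < v) :
    complexGaussian v = volume.withDensity fun z : ℂ =>
      ENNReal.ofReal ((Real.pi * v)⁻¹ * Real.exp (-(‖z‖ ^ 2 / v))) := by
  have hv' : (0 : ℝ) < v := hv
  have hv2 : v / 2 ≠ 0 := (div_pos hv two_pos).ne'
  have hmp := Complex.volume_preserving_equiv_real_prod.symm
  ext s hs
  have e1 : complexGaussian v = ((gaussianReal 0 (v / 2)).prod (gaussianReal 0 (v / 2))).map
      Complex.measurableEquivRealProd.symm := rfl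
  rw [e1, Measure.map_apply (MeasurableEquiv.measurable _) hs,
    gaussianReal_of_var_ne_zero _ hv2, prod_withDensity (measurable_gaussianPDF _ _)
      (measurable_gaussianPDF _ _), withDensity_apply _ (MeasurableEquiv.measurable _ hs),
      withDensity_apply _ hs,
    ← hmp.setLIntegral_comp_preimage hs (by fun_prop)]
  refine lintegral_congr fun p => ?_
  simp only [gaussianPDF, gaussianPDFReal, Complex.measurableEquivRealProd_symm_apply]
  rw [← ENNReal.ofReal_mul (by positivity)]
  congr 1
  rw [norm_mk_sq]
  push_cast
  have h2 : (√(2 * Real.pi * (↑v / 2)))⁻¹ * (√(2 * Real.pi * (↑v / 2)))⁻¹ = (Real.pi * v)⁻¹ := by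
    rw [← mul_inv, Real.mul_self_sqrt (by positivity)]; congr 1; ring
  rw [mul_mul_mul_comm, h2, ← Real.exp_add]
  congr 2
  field_simp
  ring

lemma whiteNoise_eq_withDensity {v : ℝ≥0} (hv : 0 < v) (n : ℕ) :
    whiteNoise v n = volume.withDensity fun z : Fin n → ℂ =>
      ENNReal.ofReal (noisePeak v n * Real.exp (-noiseEnergy v z)) := by
  have hv' : (0 : ℝ) < v := hv
  set f : ℂ → ℝ := fun z => (Real.pi * v)⁻¹ * Real.exp (-(‖z‖ ^ 2 / v)) with hf
  have hf0 : ∀ z, 0 ≤ f z := fun z => by positivity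
  have hfm : Measurable f := by fun_prop
  have hfi : Integrable f := by
    have h1 : ∫⁻ z, ENNReal.ofReal (f z) = 1 := by
      have := measure_univ (μ := complexGaussian v)
      rw [complexGaussian_eq_withDensity hv, withDensity_apply _ MeasurableSet.univ,
        Measure.restrict_univ] at this
      exact this
    refine ⟨hfm.aestronglyMeasurable, ?_⟩
    rw [hasFiniteIntegral_iff_ofReal (Filter.Eventually.of_forall hf0), h1]
    exact ENNReal.one_lt_top
  refine Measure.pi_eq (fun s hs => ?_)
  have hprod : ∀ z : Fin n → ℂ, noisePeak v n * Real.exp (-noiseEnergy v z) = ∏ i, f (z i) := by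
    intro z
    simp only [hf, Finset.prod_mul_distrib, Finset.prod_const, Finset.card_univ, Fintype.card_fin,
      ← Real.exp_sum, Finset.sum_neg_distrib, noisePeak, noiseEnergy]
  rw [withDensity_apply _ (MeasurableSet.univ_pi hs)]
  simp_rw [hprod]
  rw [volume_pi, Measure.restrict_pi_pi, ← ofReal_integral_eq_lintegral_ofReal,
    integral_fintype_prod_eq_prod (𝕜 := ℝ) (f := fun _ => f),
    ENNReal.ofReal_prod_of_nonneg]
  · refine Finset.prod_congr rfl fun i _ => ?_
    rw [complexGaussian_eq_withDensity hv, withDensity_apply _ (hs i),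
      ofReal_integral_eq_lintegral_ofReal hfi.integrableOn (Filter.Eventually.of_forall hf0)]
  · exact fun i _ => integral_nonneg hf0
  · exact Integrable.fintype_prod (f := fun _ => f) fun i => hfi.integrableOn
  · exact Filter.Eventually.of_forall fun z => Finset.prod_nonneg fun i _ => hf0 _

/-- The mean energy of the noise, relative to its variance. -/
def noiseMean (v : ℝ≥0) (n : ℕ) : ℝ≥0∞ :=
  ∫⁻ z, ENNReal.ofReal (noiseEnergy v z) ∂(whiteNoise v n)

/-- Finiteness is what allows the noise term to be cancelled in `ℝ≥0∞` when two informations are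
compared. -/
lemma noiseMean_ne_top (v : ℝ≥0) (n : ℕ) : noiseMean v n ≠ ∞ := by
  have h0 : Integrable (fun z : ℂ => ‖z‖ ^ 2) (complexGaussian v) := by
    have e1 : complexGaussian v = ((gaussianReal 0 (v / 2)).prod (gaussianReal 0 (v / 2))).map
      Complex.measurableEquivRealProd.symm := rfl
    rw [e1, integrable_map_equiv]
    have h2 : Integrable (fun x : ℝ => x ^ 2) (gaussianReal 0 (v / 2)) :=
      (memLp_id_gaussianReal 2).integrable_sq
    have h3 := (h2.comp_fst (gaussianReal 0 (v / 2))).add (h2.comp_snd (gaussianReal 0 (v / 2)))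
    refine h3.congr (Filter.Eventually.of_forall fun p => ?_)
    simp [norm_mk_sq]
  have h1 : Integrable (noiseEnergy v : (Fin n → ℂ) → ℝ) (whiteNoise v n) := by
    unfold noiseEnergy
    refine integrable_finsetSum _ fun i _ => Integrable.div_const ?_ _
    exact (measurePreserving_eval (fun _ : Fin n => complexGaussian v) i)
      |>.integrable_comp_of_integrable h0
  have := h1.hasFiniteIntegral
  rw [hasFiniteIntegral_iff_ofReal (Filter.Eventually.of_forall (noiseEnergy_nonneg v))] at this
  exact this.ne

end Noise

/-! ### Unitary invariance of white noise. -/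

section Rotation

/-- The exponent involves `ℓ` only through the squared modulus of the complex number that represents
it; this is the source of the unitary invariance. -/
lemma charFunDual_complexGaussian (v : ℝ≥0) (ℓ : StrongDual ℝ ℂ) :
    charFunDual (complexGaussian v) ℓ
      = Complex.exp (-((v / 4 * (ℓ 1 ^ 2 + ℓ Complex.I ^ 2) : ℝ) : ℂ)) := by
  have e1 : complexGaussian v = ((gaussianReal 0 (v / 2)).prod (gaussianReal 0 (v / 2))).map
      Complex.equivRealProdCLM.symm.toContinuousLinearMap := rfl
  rw [e1, charFunDual_map, charFunDual_prod, charFunDual_eq_charFun_map_one,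
    charFunDual_eq_charFun_map_one]
  set a : ℝ := ℓ 1 with ha
  set b : ℝ := ℓ Complex.I with hb
  have h1 : (gaussianReal 0 (v / 2)).map
      ((ℓ.comp Complex.equivRealProdCLM.symm.toContinuousLinearMap).comp
        (ContinuousLinearMap.inl ℝ ℝ ℝ)) = (gaussianReal 0 (v / 2)).map (fun x => a * x) := by
    congr 1
    ext x
    have : (Complex.equivRealProdCLM.symm (x, 0)) = x • (1 : ℂ) := by
      apply Complex.ext <;> simp
    change ℓ (Complex.equivRealProdCLM.symm (x, 0)) = a * x
    rw [this, map_smul, smul_eq_mul, mul_comm]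
  have h2 : (gaussianReal 0 (v / 2)).map
      ((ℓ.comp Complex.equivRealProdCLM.symm.toContinuousLinearMap).comp
        (ContinuousLinearMap.inr ℝ ℝ ℝ)) = (gaussianReal 0 (v / 2)).map (fun x => b * x) := by
    congr 1
    ext x
    have : (Complex.equivRealProdCLM.symm (0, x)) = x • Complex.I := by
      apply Complex.ext <;> simp
    change ℓ (Complex.equivRealProdCLM.symm (0, x)) = b * x
    rw [this, map_smul, smul_eq_mul, mul_comm]
  rw [h1, h2, gaussianReal_map_const_mul, gaussianReal_map_const_mul, charFun_gaussianReal,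
    charFun_gaussianReal, ← Complex.exp_add]
  congr 1
  push_cast
  ring

/-- White noise is mapped to white noise by a matrix with orthonormal rows. -/
lemma whiteNoise_map_mulVec (v : ℝ≥0) {m n : ℕ} (A : Matrix (Fin n) (Fin m) ℂ)
    (hA : A * A.conjTranspose = 1) :
    (whiteNoise v m).map (fun z => A.mulVec z) = whiteNoise v n := by
  have hAc : Continuous fun z : Fin m → ℂ => A.mulVec z := by fun_prop
  let T : (Fin m → ℂ) →L[ℝ] (Fin n → ℂ) :=
    { toLinearMap := (Matrix.mulVecLin A).restrictScalars ℝ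
      cont := hAc }
  have hT : (fun z : Fin m → ℂ => A.mulVec z) = T := rfl
  have : IsProbabilityMeasure ((whiteNoise v m).map T) :=
    Measure.isProbabilityMeasure_map T.continuous.measurable.aemeasurable
  rw [hT]
  refine Measure.ext_of_charFunDual (funext fun ℓ => ?_)
  rw [charFunDual_map]
  unfold whiteNoise
  rw [charFunDual_pi, charFunDual_pi]
  simp_rw [charFunDual_complexGaussian]
  rw [← Complex.exp_sum, ← Complex.exp_sum]
  congr 1
  rw [Finset.sum_neg_distrib, Finset.sum_neg_distrib]
  congr 1
  norm_cast
  rw [← Finset.mul_sum, ← Finset.mul_sum]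
  congr 1
  -- The real functional `ℓ` is written as `z ↦ Re ∑ w i * z i`; the minus sign comes from `Re (w *
  -- I) = -Im w`.
  let w : Fin n → ℂ := fun i => ⟨ℓ (Pi.single i 1), -ℓ (Pi.single i Complex.I)⟩
  have hℓ : ∀ z : Fin n → ℂ, ℓ z = (∑ i, w i * z i).re := by
    intro z
    have hz : z = ∑ i, ((z i).re • (Pi.single i 1 : Fin n → ℂ)
        + (z i).im • (Pi.single i Complex.I : Fin n → ℂ)) := by
      ext j
      simp only [Finset.sum_apply, Pi.add_apply, Pi.smul_apply, Pi.single_apply]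
      simp only [smul_ite, smul_zero, Complex.real_smul, mul_one, Finset.sum_add_distrib,
        Finset.sum_ite_eq, Finset.mem_univ, if_true]
      exact (Complex.re_add_im _).symm
    conv_lhs => rw [hz]
    rw [map_sum, Complex.re_sum]
    refine Finset.sum_congr rfl fun i _ => ?_
    rw [map_add, map_smul, map_smul]
    simp [w, mul_comm]
  let u : Fin m → ℂ := fun k => ∑ i, w i * A i k
  have hw : ∀ i, ℓ (Pi.single i 1) ^ 2 + ℓ (Pi.single i Complex.I) ^ 2 = ‖w i‖ ^ 2 := by
    intro i; rw [norm_mk_sq, neg_sq]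
  have hu : ∀ (k : Fin m) (c : ℂ), ℓ (T (Pi.single k c)) = (u k * c).re := by
    intro k c
    rw [hℓ, ← hT]
    simp only [Matrix.mulVec_single, u, Finset.sum_mul]
    congr 1
    refine Finset.sum_congr rfl fun i _ => ?_
    simp [Matrix.col_apply]
    ring
  have hu2 : ∀ k, ℓ (T (Pi.single k 1)) ^ 2 + ℓ (T (Pi.single k Complex.I)) ^ 2 = ‖u k‖ ^ 2 := by
    intro k
    rw [hu, hu, ← Complex.normSq_eq_norm_sq, Complex.normSq_apply]
    simp [sq]
  -- The vector `u` is the row vector `w A`, and `A A* = 1` makes `w ↦ w A` isometric.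
  have key : ∑ k, ‖u k‖ ^ 2 = ∑ i, ‖w i‖ ^ 2 := by
    have hcomplex : ((∑ k, ‖u k‖ ^ 2 : ℝ) : ℂ) = ((∑ i, ‖w i‖ ^ 2 : ℝ) : ℂ) := by
      push_cast
      simp_rw [← Complex.mul_conj']
      have e1 : ∀ k, u k = (Matrix.vecMul w A) k := fun k => rfl
      have e2 : ∀ k, (starRingEnd ℂ) (u k) = (Matrix.mulVec A.conjTranspose (star w)) k := by
        intro k
        rw [e1, ← Matrix.star_vecMul]; rfl
      have e3 : ∑ k, u k * (starRingEnd ℂ) (u k)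
          = Matrix.vecMul w A ⬝ᵥ Matrix.mulVec A.conjTranspose (star w) :=
        Finset.sum_congr rfl fun k _ => by rw [e2, e1]
      rw [e3, ← Matrix.dotProduct_mulVec, Matrix.mulVec_mulVec, hA, Matrix.one_mulVec]
      rfl
    exact_mod_cast hcomplex
  simpa [hw, hu2] using key

end Rotation

/-! ### Information over the Gaussian channel and data processing. -/

section Information

variable {Ω : Type*} [MeasurableSpace Ω]

/-- The mutual information between the underlying randomness of a signal `E` and the signal
received with additive white Gaussian noise. -/
def gaussInfo (P : Measure Ω) (v : ℝ≥0) {n : ℕ} (E : Ω → Fin n → ℂ) : ℝ≥0∞ :=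
  mutualInfo (P.prod (whiteNoise v n)) (fun p => p.1) (fun p => E p.1 + p.2)

/-- The density of the signal `E` with noise, divided by the peak of the noise density. -/
def outputDensity (P : Measure Ω) (v : ℝ≥0) {n : ℕ} (E : Ω → Fin n → ℂ) (y : Fin n → ℂ) : ℝ :=
  ∫ ω, Real.exp (-noiseEnergy v (y - E ω)) ∂P

/-- The differential entropy of the output, up to an affine normalization. -/
def outputEntropy (P : Measure Ω) (v : ℝ≥0) {n : ℕ} (E : Ω → Fin n → ℂ) : ℝ≥0∞ :=
  ∫⁻ y, ENNReal.ofReal (Real.negMulLog (outputDensity P v E y))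

/-- The data processing inequality for the mutual information. -/
lemma mutualInfo_comp_le {α β α' β' : Type*} [MeasurableSpace α] [MeasurableSpace β]
    [MeasurableSpace α'] [MeasurableSpace β'] (P : Measure Ω) [IsProbabilityMeasure P]
    {X : Ω → α} {Y : Ω → β} (hX : AEMeasurable X P) (hY : AEMeasurable Y P)
    {f : α → α'} {g : β → β'} (hf : Measurable f) (hg : Measurable g) :
    mutualInfo P (fun ω => f (X ω)) (fun ω => g (Y ω)) ≤ mutualInfo P X Y := by
  unfold mutualInfo
  have h1 : P.map (fun ω => (f (X ω), g (Y ω)))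
      = (P.map fun ω => (X ω, Y ω)).map (Prod.map f g) := by
    rw [AEMeasurable.map_map_of_aemeasurable (by fun_prop) (by fun_prop)]; rfl
  have hXp := Measure.isProbabilityMeasure_map hX
  have hYp := Measure.isProbabilityMeasure_map hY
  have hXYp := Measure.isProbabilityMeasure_map (hX.prodMk hY)
  have h2 : P.map (fun ω => f (X ω)) = (P.map X).map f := by
    rw [AEMeasurable.map_map_of_aemeasurable hf.aemeasurable hX]; rfl
  have h3 : P.map (fun ω => g (Y ω)) = (P.map Y).map g := by
    rw [AEMeasurable.map_map_of_aemeasurable hg.aemeasurable hY]; rfl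
  rw [h1, h2, h3, Measure.map_prod_map _ _ hf hg]
  exact InformationTheory.klDiv_map_le _ _ (by fun_prop)

lemma mutualInfo_congr {α β : Type*} [MeasurableSpace α] [MeasurableSpace β] {P : Measure Ω}
    {X X' : Ω → α} {Y Y' : Ω → β} (hX : X =ᵐ[P] X') (hY : Y =ᵐ[P] Y') :
    mutualInfo P X Y = mutualInfo P X' Y' := by
  unfold mutualInfo
  rw [Measure.map_congr hX, Measure.map_congr hY,
    Measure.map_congr (f := fun ω => (X ω, Y ω)) (g := fun ω => (X' ω, Y' ω))
      (by filter_upwards [hX, hY] with ω h1 h2; rw [h1, h2])]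

end Information

/-! ### Information as a difference of entropies. -/

section Entropy

variable {Ω : Type*} [MeasurableSpace Ω]

lemma exp_neg_noiseEnergy_le_one (v : ℝ≥0) {n : ℕ} (z : Fin n → ℂ) :
    Real.exp (-noiseEnergy v z) ≤ 1 :=
  Real.exp_le_one_iff.2 (neg_nonpos.2 (noiseEnergy_nonneg v z))

lemma integrable_exp_neg_noiseEnergy (P : Measure Ω) [IsFiniteMeasure P] (v : ℝ≥0) {n : ℕ}
    {E : Ω → Fin n → ℂ} (hE : AEMeasurable E P) (y : Fin n → ℂ) :
    Integrable (fun ω => Real.exp (-noiseEnergy v (y - E ω))) P := by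
  refine Integrable.of_bound (C := 1) ?_ (Filter.Eventually.of_forall fun ω => ?_)
  · have hc : Continuous fun x : Fin n → ℂ => Real.exp (-noiseEnergy v (y - x)) := by fun_prop
    exact (hc.measurable.comp_aemeasurable hE).aestronglyMeasurable
  · rw [Real.norm_of_nonneg (Real.exp_pos _).le]
    exact exp_neg_noiseEnergy_le_one _ _

lemma outputDensity_pos (P : Measure Ω) [IsProbabilityMeasure P] (v : ℝ≥0) {n : ℕ}
    {E : Ω → Fin n → ℂ} (hE : AEMeasurable E P) (y : Fin n → ℂ) : 0 < outputDensity P v E y :=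
  integral_exp_pos (integrable_exp_neg_noiseEnergy P v hE y)

lemma outputDensity_nonneg (P : Measure Ω) (v : ℝ≥0) {n : ℕ}
    (E : Ω → Fin n → ℂ) (y : Fin n → ℂ) : 0 ≤ outputDensity P v E y :=
  integral_nonneg fun _ => (Real.exp_pos _).le

lemma outputDensity_le_one (P : Measure Ω) [IsProbabilityMeasure P] (v : ℝ≥0) {n : ℕ}
    (E : Ω → Fin n → ℂ) (y : Fin n → ℂ) : outputDensity P v E y ≤ 1 := by
  by_cases hi : Integrable (fun ω => Real.exp (-noiseEnergy v (y - E ω))) P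
  · calc outputDensity P v E y ≤ ∫ _, 1 ∂P :=
        integral_mono hi (integrable_const _) fun ω => exp_neg_noiseEnergy_le_one _ _
      _ = 1 := by simp
  · rw [outputDensity, integral_undef hi]; exact zero_le_one

lemma stronglyMeasurable_outputDensity_uncurry {T : Type*} [MeasurableSpace T]
    (P : Measure Ω) [SFinite P] (v : ℝ≥0) {n : ℕ} {E : T × Ω → Fin n → ℂ} (hE : Measurable E) :
    StronglyMeasurable
      fun p : T × (Fin n → ℂ) => outputDensity P v (fun ω => E (p.1, ω)) p.2 := by
  unfold outputDensity
  refine StronglyMeasurable.integral_prod_right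
    (f := fun (p : T × (Fin n → ℂ)) ω => Real.exp (-noiseEnergy v (p.2 - E (p.1, ω)))) ?_
  have : Continuous fun x : Fin n → ℂ => Real.exp (-noiseEnergy v x) := by fun_prop
  exact (this.measurable.comp (by fun_prop)).stronglyMeasurable

lemma measurable_outputDensity (P : Measure Ω) [SFinite P] (v : ℝ≥0) {n : ℕ}
    {E : Ω → Fin n → ℂ} (hE : Measurable E) : Measurable (outputDensity P v E) := by
  unfold outputDensity
  refine (StronglyMeasurable.integral_prod_right
    (f := fun (y : Fin n → ℂ) ω => Real.exp (-noiseEnergy v (y - E ω))) ?_).measurable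
  have : Continuous fun x : Fin n → ℂ => Real.exp (-noiseEnergy v x) := by fun_prop
  exact (this.measurable.comp (by fun_prop)).stronglyMeasurable

lemma outputDensity_congr {P : Measure Ω} {v : ℝ≥0} {n : ℕ} {E E' : Ω → Fin n → ℂ}
    (h : E =ᵐ[P] E') : outputDensity P v E = outputDensity P v E' := by
  ext y
  refine integral_congr_ae ?_
  filter_upwards [h] with ω hω
  rw [hω]

lemma gaussInfo_congr {P : Measure Ω} [SFinite P] {v : ℝ≥0} {n : ℕ} {E E' : Ω → Fin n → ℂ}
    (h : E =ᵐ[P] E') : gaussInfo P v E = gaussInfo P v E' := by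
  refine mutualInfo_congr (ae_eq_refl _) ?_
  have := (Measure.quasiMeasurePreserving_fst (μ := P) (ν := whiteNoise v n)).ae_eq_comp h
  filter_upwards [this] with p hp
  simp only [Function.comp_apply] at hp
  rw [hp]

/-- The mutual information over the Gaussian channel as a difference of differential entropies,
for measurable signals. -/
lemma gaussInfo_add_noiseMean_of_measurable (P : Measure Ω) [IsProbabilityMeasure P] {v : ℝ≥0}
    (hv : 0 < v) {n : ℕ} {E : Ω → Fin n → ℂ} (hE : Measurable E) :
    gaussInfo P v E + noiseMean v n = ENNReal.ofReal (noisePeak v n) * outputEntropy P v E := by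
  have hM := noisePeak_pos hv n
  set M := noisePeak v n with hMdef
  set W := whiteNoise v n with hW
  set q := outputDensity P v E with hq
  have hqm : Measurable q := measurable_outputDensity P v hE
  have hq0 : ∀ y, 0 < q y := outputDensity_pos P v hE.aemeasurable
  have hq1 : ∀ y, q y ≤ 1 := outputDensity_le_one P v E
  have hem : Measurable (noiseEnergy v : (Fin n → ℂ) → ℝ) := (continuous_noiseEnergy v n).measurable
  set w : (Fin n → ℂ) → ℝ≥0∞ := fun z => ENNReal.ofReal (M * Real.exp (-noiseEnergy v z)) with hw
  have hwm : Measurable w := by fun_prop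
  have hWw : W = volume.withDensity w := whiteNoise_eq_withDensity hv n
  set p : (Fin n → ℂ) → ℝ≥0∞ := fun y => ENNReal.ofReal (M * q y) with hp
  have hpm : Measurable p := by fun_prop
  set Jm : Measure (Ω × (Fin n → ℂ)) :=
    (P.prod W).map (fun x => (x.1, E x.1 + x.2)) with hJm
  -- Given `ω`, the output is the noise translated by `E ω`, so its density is `w (y - E ω)`.
  have hJ_lint : ∀ f : Ω × (Fin n → ℂ) → ℝ≥0∞, Measurable f →
      ∫⁻ x, f x ∂Jm = ∫⁻ ω, ∫⁻ y, w (y - E ω) * f (ω, y) ∂volume ∂P := by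
    intro f hf
    rw [hJm, lintegral_map hf (by fun_prop), lintegral_prod _ (by fun_prop)]
    refine lintegral_congr fun ω => ?_
    rw [hWw, lintegral_withDensity_eq_lintegral_mul _ hwm (by fun_prop)]
    rw [← lintegral_add_right_eq_self (μ := volume)
      (fun y => w (y - E ω) * f (ω, y)) (E ω)]
    refine lintegral_congr fun z => ?_
    simp [add_comm z]
  have hJ_dens : Jm = (P.prod volume).withDensity (fun x => w (x.2 - E x.1)) := by
    refine Measure.ext_of_lintegral _ fun f hf => ?_
    rw [hJ_lint f hf, lintegral_withDensity_eq_lintegral_mul _ (by fun_prop) hf,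
      lintegral_prod _ (by fun_prop)]
    rfl
  have hp_eq : ∀ y, ∫⁻ ω, w (y - E ω) ∂P = p y := by
    intro y
    simp only [hw, hp, ENNReal.ofReal_mul hM.le]
    rw [lintegral_const_mul _ (by fun_prop), hq, outputDensity,
      ofReal_integral_eq_lintegral_ofReal (integrable_exp_neg_noiseEnergy P v hE.aemeasurable y)
        (Filter.Eventually.of_forall fun _ => (Real.exp_pos _).le)]
  have hsnd : Jm.map Prod.snd = volume.withDensity p := by
    refine Measure.ext_of_lintegral _ fun f hf => ?_
    rw [lintegral_map hf measurable_snd, hJ_lint _ (by fun_prop), lintegral_lintegral_swap (by fun_prop),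
      lintegral_withDensity_eq_lintegral_mul _ hpm hf]
    refine lintegral_congr fun y => ?_
    change ∫⁻ ω, w (y - E ω) * f y ∂P = p y * f y
    rw [lintegral_mul_const _ (by fun_prop), hp_eq]
  have hJprob : IsProbabilityMeasure Jm :=
    Measure.isProbabilityMeasure_map (by fun_prop)
  have hsndprob : IsProbabilityMeasure (volume.withDensity p) := by
    rw [← hsnd]; exact Measure.isProbabilityMeasure_map (by fun_prop)
  set ν := P.prod (volume.withDensity p) with hν
  -- The density of the joint law relative to the product of its marginals; the peak `M` of the
  -- noise density cancels in the quotient.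
  set F : Ω × (Fin n → ℂ) → ℝ := fun x => Real.exp (-noiseEnergy v (x.2 - E x.1)) / q x.2 with hF
  have hF0 : ∀ x, 0 ≤ F x := fun x => div_nonneg (Real.exp_pos _).le (hq0 _).le
  have hFm : Measurable F := by fun_prop
  have hJν : Jm = ν.withDensity fun x => ENNReal.ofReal (F x) := by
    rw [hJ_dens, hν, prod_withDensity_right hpm, ← withDensity_mul _ (by fun_prop) (by fun_prop)]
    congr 1
    ext x
    simp only [hw, hp, hF, Pi.mul_apply]
    rw [← ENNReal.ofReal_mul (mul_nonneg hM.le (hq0 _).le)]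
    congr 1
    field_simp [(hq0 x.2).ne']
  have hmi : gaussInfo P v E = InformationTheory.klDiv Jm ν := by
    unfold gaussInfo mutualInfo
    have h1 : (P.prod W).map (fun p => p.1) = P := Measure.fst_prod
    have h2 : (P.prod W).map (fun p => E p.1 + p.2) = volume.withDensity p := by
      rw [← hsnd, hJm, Measure.map_map (by fun_prop) (by fun_prop)]; rfl
    rw [← hW, h1, h2]
  have hac : Jm ≪ ν := by rw [hJν]; exact withDensity_absolutelyContinuous _ _
  have hrn : ∀ᵐ x ∂ν, (Jm.rnDeriv ν x).toReal = F x := by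
    have := Measure.rnDeriv_withDensity ν (f := fun x => ENNReal.ofReal (F x)) (by fun_prop)
    rw [← hJν] at this
    filter_upwards [this] with x hx
    rw [hx, ENNReal.toReal_ofReal (hF0 x)]
  have hkl : gaussInfo P v E = ∫⁻ x, ENNReal.ofReal (InformationTheory.klFun (F x)) ∂ν := by
    rw [hmi, InformationTheory.klDiv_eq_lintegral_klFun_of_ac hac]
    refine lintegral_congr_ae ?_
    filter_upwards [hrn] with x hx
    rw [hx]
  have hA : ∫⁻ x, ENNReal.ofReal (F x * noiseEnergy v (x.2 - E x.1)) ∂ν = noiseMean v n := by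
    have : ∫⁻ x, ENNReal.ofReal (noiseEnergy v (x.2 - E x.1)) ∂Jm = noiseMean v n := by
      rw [hJm, lintegral_map (by fun_prop) (by fun_prop), noiseMean]
      simp only [add_sub_cancel_left]
      have := lintegral_map (μ := P.prod W) (f := fun z => ENNReal.ofReal (noiseEnergy v z))
        (g := Prod.snd) (by fun_prop) measurable_snd
      rw [← this]
      congr 1
      exact Measure.snd_prod
    rw [← this, hJν, lintegral_withDensity_eq_lintegral_mul _ (by fun_prop) (by fun_prop)]
    refine lintegral_congr fun x => ?_
    rw [Pi.mul_apply, ENNReal.ofReal_mul (hF0 x)]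
  have hB : ∫⁻ x, ENNReal.ofReal (F x) ∂ν = 1 := by
    have := measure_univ (μ := Jm)
    rwa [hJν, withDensity_apply _ MeasurableSet.univ, Measure.restrict_univ] at this
  have hC : ∫⁻ x, ENNReal.ofReal (F x * -Real.log (q x.2)) ∂ν
      = ENNReal.ofReal M * outputEntropy P v E := by
    have hnm : Measurable fun y => ENNReal.ofReal (Real.negMulLog (outputDensity P v E y)) :=
      (Real.continuous_negMulLog.measurable.comp hqm).ennreal_ofReal
    have h1 : ∫⁻ x, ENNReal.ofReal (F x * -Real.log (q x.2)) ∂ν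
        = ∫⁻ x, ENNReal.ofReal (-Real.log (q x.2)) ∂Jm := by
      rw [hJν, lintegral_withDensity_eq_lintegral_mul _ (by fun_prop) (by fun_prop)]
      refine lintegral_congr fun x => ?_
      rw [Pi.mul_apply, ENNReal.ofReal_mul (hF0 x)]
    rw [h1, ← lintegral_map (μ := Jm) (f := fun y => ENNReal.ofReal (-Real.log (q y)))
      (g := Prod.snd) (by fun_prop) measurable_snd, hsnd,
      lintegral_withDensity_eq_lintegral_mul _ hpm (by fun_prop), outputEntropy,
      ← lintegral_const_mul (ENNReal.ofReal M) hnm]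
    refine lintegral_congr fun y => ?_
    rw [Pi.mul_apply, ← ENNReal.ofReal_mul (mul_nonneg hM.le (hq0 y).le),
      ← ENNReal.ofReal_mul hM.le]
    congr 1
    rw [Real.negMulLog]; ring
  -- This is `klFun x = x log x + 1 - x` with `log F` expanded. The terms are arranged so that each
  -- one is nonnegative, using `q ≤ 1`; the identity then integrates in `ℝ≥0∞` even if the entropy
  -- is infinite.
  have hpt : ∀ x, ENNReal.ofReal (InformationTheory.klFun (F x))
      + ENNReal.ofReal (F x * noiseEnergy v (x.2 - E x.1)) + ENNReal.ofReal (F x)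
      = ENNReal.ofReal (F x * -Real.log (q x.2)) + 1 := by
    intro x
    have hl : 0 ≤ -Real.log (q x.2) := neg_nonneg.2 (Real.log_nonpos (hq0 _).le (hq1 _))
    rw [← ENNReal.ofReal_one, ← ENNReal.ofReal_add (InformationTheory.klFun_nonneg (hF0 x))
      (mul_nonneg (hF0 x) (noiseEnergy_nonneg _ _)), ← ENNReal.ofReal_add _ (hF0 x),
      ← ENNReal.ofReal_add (mul_nonneg (hF0 x) hl) zero_le_one]
    · congr 1
      have : Real.log (F x) = -noiseEnergy v (x.2 - E x.1) - Real.log (q x.2) := by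
        rw [hF]
        simp only
        rw [Real.log_div (Real.exp_pos _).ne' (hq0 _).ne', Real.log_exp]
      rw [InformationTheory.klFun_apply, this]
      ring
    · exact add_nonneg (InformationTheory.klFun_nonneg (hF0 x))
        (mul_nonneg (hF0 x) (noiseEnergy_nonneg _ _))
  have hsum := lintegral_congr (μ := ν) hpt
  have hklm : Measurable fun x => InformationTheory.klFun (F x) :=
    InformationTheory.measurable_klFun.comp hFm
  rw [lintegral_add_right _ (by fun_prop), lintegral_add_right _ (by fun_prop),
    lintegral_add_right _ (by fun_prop), hA, hB, hC, ← hkl] at hsum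
  simp only [lintegral_const, measure_univ, mul_one] at hsum
  exact (ENNReal.add_left_inj ENNReal.one_ne_top).1 hsum

/-- The mutual information over the Gaussian channel as a difference of differential entropies. -/
lemma gaussInfo_add_noiseMean (P : Measure Ω) [IsProbabilityMeasure P] {v : ℝ≥0}
    (hv : 0 < v) {n : ℕ} {E : Ω → Fin n → ℂ} (hE : AEMeasurable E P) :
    gaussInfo P v E + noiseMean v n = ENNReal.ofReal (noisePeak v n) * outputEntropy P v E := by
  rw [gaussInfo_congr hE.ae_eq_mk, gaussInfo_add_noiseMean_of_measurable P hv hE.measurable_mk,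
    outputEntropy, outputEntropy, outputDensity_congr hE.ae_eq_mk]

end Entropy

/-! ### Invariance, semicontinuity and concavity of the information. -/

section Comparison

attribute [local irreducible] outputDensity

variable {Ω Ω' : Type*} [MeasurableSpace Ω] [MeasurableSpace Ω']

lemma gaussInfo_le_of_outputEntropy_le {P : Measure Ω} [IsProbabilityMeasure P] {P' : Measure Ω'}
    [IsProbabilityMeasure P'] {v : ℝ≥0} (hv : 0 < v) {n : ℕ} {E : Ω → Fin n → ℂ}
    {E' : Ω' → Fin n → ℂ} (hE : AEMeasurable E P) (hE' : AEMeasurable E' P')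
    (h : outputEntropy P v E ≤ outputEntropy P' v E') : gaussInfo P v E ≤ gaussInfo P' v E' := by
  rw [← ENNReal.add_le_add_iff_right (noiseMean_ne_top v n), gaussInfo_add_noiseMean P hv hE,
    gaussInfo_add_noiseMean P' hv hE']
  gcongr

lemma gaussInfo_eq_of_outputEntropy_eq {P : Measure Ω} [IsProbabilityMeasure P] {P' : Measure Ω'}
    [IsProbabilityMeasure P'] {v : ℝ≥0} (hv : 0 < v) {n : ℕ} {E : Ω → Fin n → ℂ}
    {E' : Ω' → Fin n → ℂ} (hE : AEMeasurable E P) (hE' : AEMeasurable E' P')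
    (h : outputEntropy P v E = outputEntropy P' v E') : gaussInfo P v E = gaussInfo P' v E' :=
  le_antisymm (gaussInfo_le_of_outputEntropy_le hv hE hE' h.le)
    (gaussInfo_le_of_outputEntropy_le hv hE' hE h.ge)

lemma outputDensity_comp {P : Measure Ω} {P' : Measure Ω'} {T : Ω' → Ω}
    (hT : MeasurePreserving T P' P) (v : ℝ≥0) {n : ℕ} {E : Ω → Fin n → ℂ}
    (hE : AEMeasurable E P) : outputDensity P' v (fun ω => E (T ω)) = outputDensity P v E := by
  ext y
  unfold outputDensity
  have hc : Continuous fun x : Fin n → ℂ => Real.exp (-noiseEnergy v (y - x)) := by fun_prop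
  rw [← hT.map_eq, integral_map hT.measurable.aemeasurable]
  rw [hT.map_eq]
  exact (hc.measurable.comp_aemeasurable hE).aestronglyMeasurable

/-- The information over the Gaussian channel depends on the law of the signal only. -/
lemma gaussInfo_comp {P : Measure Ω} [IsProbabilityMeasure P] {P' : Measure Ω'}
    [IsProbabilityMeasure P'] {T : Ω' → Ω} (hT : MeasurePreserving T P' P) {v : ℝ≥0} (hv : 0 < v)
    {n : ℕ} {E : Ω → Fin n → ℂ} (hE : AEMeasurable E P) :
    gaussInfo P' v (fun ω => E (T ω)) = gaussInfo P v E := by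
  refine gaussInfo_eq_of_outputEntropy_eq hv (hE.comp_quasiMeasurePreserving
    hT.quasiMeasurePreserving) hE ?_
  rw [outputEntropy, outputEntropy, outputDensity_comp hT v hE]

lemma mutualInfo_comp_measurePreserving {α β : Type*} [MeasurableSpace α] [MeasurableSpace β]
    {P : Measure Ω} {P' : Measure Ω'} {T : Ω' → Ω} (hT : MeasurePreserving T P' P)
    {X : Ω → α} {Y : Ω → β} (hX : AEMeasurable X P) (hY : AEMeasurable Y P) :
    mutualInfo P' (fun ω => X (T ω)) (fun ω => Y (T ω)) = mutualInfo P X Y := by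
  unfold mutualInfo
  rw [← hT.map_eq] at hX hY ⊢
  rw [AEMeasurable.map_map_of_aemeasurable hX hT.measurable.aemeasurable,
    AEMeasurable.map_map_of_aemeasurable hY hT.measurable.aemeasurable,
    AEMeasurable.map_map_of_aemeasurable (hX.prodMk hY) hT.measurable.aemeasurable]
  rfl

lemma aemeasurable_add_noise {P : Measure Ω} [SFinite P] (v : ℝ≥0) {n : ℕ} {E : Ω → Fin n → ℂ}
    (hE : AEMeasurable E P) :
    AEMeasurable (fun p : Ω × (Fin n → ℂ) => E p.1 + p.2) (P.prod (whiteNoise v n)) :=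
  (hE.comp_quasiMeasurePreserving Measure.quasiMeasurePreserving_fst).add
    measurable_snd.aemeasurable

lemma mutualInfo_le_gaussInfo {α : Type*} [MeasurableSpace α] {P : Measure Ω}
    [IsProbabilityMeasure P] {v : ℝ≥0} {n : ℕ} {E : Ω → Fin n → ℂ} (hE : AEMeasurable E P)
    {X : Ω → α} (hX : AEMeasurable X P) :
    mutualInfo (P.prod (whiteNoise v n)) (fun p => X p.1) (fun p => E p.1 + p.2)
      ≤ gaussInfo P v E := by
  have h := (Measure.quasiMeasurePreserving_fst (μ := P) (ν := whiteNoise v n)).ae_eq_comp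
    hX.ae_eq_mk
  rw [mutualInfo_congr (X' := fun p => hX.mk X p.1) h (ae_eq_refl _)]
  exact mutualInfo_comp_le _ (X := fun p : Ω × (Fin n → ℂ) => p.1) (Y := fun p => E p.1 + p.2)
    (g := id)
    measurable_fst.aemeasurable (aemeasurable_add_noise v hE) hX.measurable_mk measurable_id

/-- The information about the underlying randomness is the information about the signal. -/
lemma mutualInfo_self_eq_gaussInfo {P : Measure Ω} [IsProbabilityMeasure P] {v : ℝ≥0}
    (hv : 0 < v) {n : ℕ} {E : Ω → Fin n → ℂ} (hE : AEMeasurable E P) :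
    mutualInfo (P.prod (whiteNoise v n)) (fun p => E p.1) (fun p => E p.1 + p.2)
      = gaussInfo P v E := by
  wlog hm : Measurable E generalizing E
  · have h := (Measure.quasiMeasurePreserving_fst (μ := P) (ν := whiteNoise v n)).ae_eq_comp
      hE.ae_eq_mk
    rw [gaussInfo_congr hE.ae_eq_mk, ← this hE.measurable_mk.aemeasurable hE.measurable_mk]
    refine mutualInfo_congr h ?_
    filter_upwards [h] with p hp
    simp only [Function.comp_apply] at hp
    rw [hp]
  have := Measure.isProbabilityMeasure_map hE
  -- Both sides are transported to the space of signals with the law of `E`, where the underlying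
  -- randomness is the signal itself.
  have hT : MeasurePreserving E P (P.map E) := ⟨hm, rfl⟩
  have hT2 : MeasurePreserving (Prod.map E (id : (Fin n → ℂ) → _)) (P.prod (whiteNoise v n))
      ((P.map E).prod (whiteNoise v n)) := hT.prod (MeasurePreserving.id _)
  refine Eq.trans ?_ (gaussInfo_comp (P := P.map E) hT hv (E := id) aemeasurable_id).symm
  exact mutualInfo_comp_measurePreserving hT2 (X := fun p => p.1) (Y := fun p => p.1 + p.2)
    (by fun_prop) (by fun_prop)

/-- Apply `A` to the received vector: data processing bounds the result, and the transformed noise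
is again white by `whiteNoise_map_mulVec`. -/
lemma gaussInfo_mulVec_le {P : Measure Ω} [IsProbabilityMeasure P] {v : ℝ≥0} {m n : ℕ}
    {E : Ω → Fin m → ℂ} (hE : AEMeasurable E P) (A : Matrix (Fin n) (Fin m) ℂ)
    (hA : A * A.conjTranspose = 1) :
    gaussInfo P v (fun ω => A.mulVec (E ω)) ≤ gaussInfo P v E := by
  have hAm : Measurable fun z : Fin m → ℂ => A.mulVec z :=
    Continuous.measurable (by fun_prop)
  have hT : MeasurePreserving (Prod.map (id : Ω → Ω) fun z : Fin m → ℂ => A.mulVec z)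
      (P.prod (whiteNoise v m)) (P.prod (whiteNoise v n)) :=
    (MeasurePreserving.id P).prod ⟨hAm, whiteNoise_map_mulVec v A hA⟩
  rw [gaussInfo, ← mutualInfo_comp_measurePreserving hT (X := fun p => p.1)
    (Y := fun p => A.mulVec (E p.1) + p.2) measurable_fst.aemeasurable
    (aemeasurable_add_noise v (hAm.comp_aemeasurable hE))]
  have := mutualInfo_comp_le (P.prod (whiteNoise v m))
    (X := fun p : Ω × (Fin m → ℂ) => p.1) (Y := fun p => E p.1 + p.2) (f := id)
    measurable_fst.aemeasurable (aemeasurable_add_noise v hE) measurable_id hAm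
  simp only [Matrix.mulVec_add] at this
  exact this

/-- An offset translates the output density, and Lebesgue measure is translation invariant. -/
lemma gaussInfo_add_const {P : Measure Ω} [IsProbabilityMeasure P] {v : ℝ≥0} (hv : 0 < v) {n : ℕ}
    {E : Ω → Fin n → ℂ} (hE : AEMeasurable E P) (c : Fin n → ℂ) :
    gaussInfo P v (fun ω => E ω + c) = gaussInfo P v E := by
  refine gaussInfo_eq_of_outputEntropy_eq hv (hE.add_const c) hE ?_
  have h : ∀ y, outputDensity P v (fun ω => E ω + c) y = outputDensity P v E (y - c) := by
    intro y
    unfold outputDensity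
    refine integral_congr_ae (Filter.Eventually.of_forall fun ω => ?_)
    simp only
    congr 3
    abel
  unfold outputEntropy
  simp_rw [h]
  exact lintegral_sub_right_eq_self
    (fun y => ENNReal.ofReal (Real.negMulLog (outputDensity P v E y))) c

/-- Lower semicontinuity of the information over the Gaussian channel. -/
lemma eventually_lt_gaussInfo {ι : Type*} {l : Filter ι} [l.IsCountablyGenerated] [l.NeBot]
    {P : Measure Ω}
    [IsProbabilityMeasure P] {v : ℝ≥0} (hv : 0 < v) {n : ℕ} {E : ι → Ω → Fin n → ℂ}
    {E₀ : Ω → Fin n → ℂ} (hE : ∀ i, AEMeasurable (E i) P) (hE₀ : AEMeasurable E₀ P)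
    (hlim : ∀ᵐ ω ∂P, Filter.Tendsto (fun i => E i ω) l (nhds (E₀ ω))) {c : ℝ≥0∞}
    (hc : c < gaussInfo P v E₀) : ∀ᶠ i in l, c < gaussInfo P v (E i) := by
  have hM0 : ENNReal.ofReal (noisePeak v n) ≠ 0 :=
    (ENNReal.ofReal_pos.2 (noisePeak_pos hv n)).ne'
  have key : ∀ {E' : Ω → Fin n → ℂ}, AEMeasurable E' P → (c < gaussInfo P v E' ↔
      (c + noiseMean v n) / ENNReal.ofReal (noisePeak v n) < outputEntropy P v E') := by
    intro E' hE'
    rw [← ENNReal.add_lt_add_iff_right (noiseMean_ne_top v n), gaussInfo_add_noiseMean P hv hE',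
      ENNReal.div_lt_iff (Or.inl hM0) (Or.inl ENNReal.ofReal_ne_top), mul_comm]
  rw [key hE₀] at hc
  have hq : ∀ y, Filter.Tendsto (fun i => outputDensity P v (E i) y) l
      (nhds (outputDensity P v E₀ y)) := by
    intro y
    have hcont : Continuous fun x : Fin n → ℂ => Real.exp (-noiseEnergy v (y - x)) := by fun_prop
    unfold outputDensity
    refine tendsto_integral_filter_of_dominated_convergence (fun _ => 1)
      (Filter.Eventually.of_forall fun i =>
        (integrable_exp_neg_noiseEnergy P v (hE i) y).aestronglyMeasurable)
      (Filter.Eventually.of_forall fun i => Filter.Eventually.of_forall fun ω => ?_)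
      (integrable_const _) ?_
    · rw [Real.norm_of_nonneg (Real.exp_pos _).le]
      exact exp_neg_noiseEnergy_le_one _ _
    · filter_upwards [hlim] with ω hω
      exact (hcont.tendsto _).comp hω
  -- Fatou's lemma: the integrands are nonnegative and converge pointwise, as the output densities
  -- do by dominated convergence.
  have hS : outputEntropy P v E₀ ≤ Filter.liminf (fun i => outputEntropy P v (E i)) l := by
    refine le_trans (le_of_eq ?_) (lintegral_liminf_le' fun i => ?_)
    · refine lintegral_congr fun y => ?_
      exact ((ENNReal.tendsto_ofReal
        ((Real.continuous_negMulLog.tendsto _).comp (hq y))).liminf_eq).symm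
    · rw [outputDensity_congr (hE i).ae_eq_mk]
      exact ((Real.continuous_negMulLog.measurable.comp
        (measurable_outputDensity P v (hE i).measurable_mk)).ennreal_ofReal).aemeasurable
  filter_upwards [Filter.eventually_lt_of_lt_liminf (hc.trans_le hS)] with i hi
  exact (key (hE i)).2 hi

/-- Concavity of the information over the Gaussian channel: conditioning on a component of the
randomness does not increase it. -/
lemma le_gaussInfo_prod {T : Type*} [MeasurableSpace T] {π : Measure T} [IsProbabilityMeasure π]
    {P : Measure Ω} [IsProbabilityMeasure P] {v : ℝ≥0} (hv : 0 < v) {n : ℕ}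
    {E : T × Ω → Fin n → ℂ} (hE : AEMeasurable E (π.prod P)) {c : ℝ≥0∞}
    (hc : ∀ᵐ t ∂π, c ≤ gaussInfo P v (fun ω => E (t, ω))) : c ≤ gaussInfo (π.prod P) v E := by
  wlog hm : Measurable E generalizing E
  · rw [gaussInfo_congr hE.ae_eq_mk]
    refine this hE.measurable_mk.aemeasurable ?_ hE.measurable_mk
    filter_upwards [hc, Measure.ae_ae_of_ae_prod hE.ae_eq_mk] with t h1 h2
    rwa [← gaussInfo_congr h2]
  have hunc := (stronglyMeasurable_outputDensity_uncurry P v hm).measurable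
  -- The output density is the mean over `t` of the conditional ones, and `-x log x` is concave.
  have hjensen : ∀ y, ∫⁻ t, ENNReal.ofReal (Real.negMulLog
      (outputDensity P v (fun ω => E (t, ω)) y)) ∂π
        ≤ ENNReal.ofReal (Real.negMulLog (outputDensity (π.prod P) v E y)) := by
    intro y
    have hqm : Measurable fun t => outputDensity P v (fun ω => E (t, ω)) y := by
      have := hunc.comp (measurable_prodMk_right (y := y))
      exact this
    have h0 : ∀ t, 0 ≤ outputDensity P v (fun ω => E (t, ω)) y :=
      fun t => outputDensity_nonneg _ _ _ _
    have h1 : ∀ t, outputDensity P v (fun ω => E (t, ω)) y ≤ 1 :=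
      fun t => outputDensity_le_one _ _ _ _
    have hi : Integrable (fun t => outputDensity P v (fun ω => E (t, ω)) y) π :=
      Integrable.of_bound (C := 1) hqm.aestronglyMeasurable
        (Filter.Eventually.of_forall fun t => by rw [Real.norm_of_nonneg (h0 t)]; exact h1 t)
    have hn0 : ∀ t, 0 ≤ Real.negMulLog (outputDensity P v (fun ω => E (t, ω)) y) :=
      fun t => Real.negMulLog_nonneg (h0 t) (h1 t)
    have hn1 : ∀ t, Real.negMulLog (outputDensity P v (fun ω => E (t, ω)) y) ≤ 1 := by
      intro t
      have := Real.negMulLog_le_one_sub_self (h0 t)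
      linarith [h0 t]
    have hni : Integrable
        (fun t => Real.negMulLog (outputDensity P v (fun ω => E (t, ω)) y)) π :=
      Integrable.of_bound (C := 1)
        (Real.continuous_negMulLog.measurable.comp hqm).aestronglyMeasurable
        (Filter.Eventually.of_forall fun t => by rw [Real.norm_of_nonneg (hn0 t)]; exact hn1 t)
    rw [← ofReal_integral_eq_lintegral_ofReal hni (Filter.Eventually.of_forall hn0)]
    have hq : outputDensity (π.prod P) v E y
        = ∫ t, outputDensity P v (fun ω => E (t, ω)) y ∂π := by
      unfold outputDensity
      exact integral_prod _ (integrable_exp_neg_noiseEnergy _ v hE y)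
    rw [hq]
    exact ENNReal.ofReal_le_ofReal (Real.concaveOn_negMulLog.le_map_integral
      Real.continuous_negMulLog.continuousOn isClosed_Ici (Filter.Eventually.of_forall h0) hi hni)
  rw [← ENNReal.add_le_add_iff_right (noiseMean_ne_top v n), gaussInfo_add_noiseMean _ hv hE]
  have h2 : ∫⁻ t, outputEntropy P v (fun ω => E (t, ω)) ∂π ≤ outputEntropy (π.prod P) v E := by
    unfold outputEntropy
    rw [lintegral_lintegral_swap
      ((Real.continuous_negMulLog.measurable.comp hunc).ennreal_ofReal).aemeasurable]
    exact lintegral_mono hjensen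
  calc c + noiseMean v n = ∫⁻ _, (c + noiseMean v n) ∂π := by simp
    _ ≤ ∫⁻ t, ENNReal.ofReal (noisePeak v n) * outputEntropy P v (fun ω => E (t, ω)) ∂π := by
      refine lintegral_mono_ae ?_
      filter_upwards [hc] with t ht
      rw [← gaussInfo_add_noiseMean P hv (E := fun ω => E (t, ω))
        (hm.comp measurable_prodMk_left).aemeasurable]
      gcongr
    _ = ENNReal.ofReal (noisePeak v n) * ∫⁻ t, outputEntropy P v (fun ω => E (t, ω)) ∂π :=
      lintegral_const_mul' _ _ ENNReal.ofReal_ne_top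
    _ ≤ _ := by gcongr

end Comparison

/-! ### Continuity and decay of the Green function. -/

section Green

lemma continuous_green (lam : ℝ) {d : ℝ} (hd : 0 < d) (hlam : 0 < lam) :
    Continuous (green lam d) := by
  have hρ : ∀ x : ℝ, √(x ^ 2 + d ^ 2) ≠ 0 := fun x => (Real.sqrt_pos.2 (by positivity)).ne'
  have hk : 2 * Real.pi / lam ≠ 0 := by positivity
  have hρc : Continuous fun x : ℝ => √(x ^ 2 + d ^ 2) := by fun_prop
  unfold green
  simp only
  refine Continuous.mul (Continuous.div (by fun_prop) (by fun_prop) fun x => ?_)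
    (Continuous.sub (Continuous.add ?_ (Continuous.mul ?_ ?_)) ?_)
  · have := hρ x
    exact_mod_cast mul_ne_zero (by positivity) this
  · exact Complex.continuous_ofReal.comp
      (continuous_const.div (by fun_prop) fun x => pow_ne_zero _ (hρ x))
  · refine continuous_const.div (by fun_prop) fun x => ?_
    exact_mod_cast mul_ne_zero hk (hρ x)
  · exact Complex.continuous_ofReal.comp
      (Continuous.div (by fun_prop) (by fun_prop) fun x => pow_ne_zero _ (hρ x))
  · exact Complex.continuous_ofReal.comp
      ((continuous_const.div (by fun_prop) fun x => mul_ne_zero (pow_ne_zero _ hk)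
        (pow_ne_zero _ (hρ x))).mul
        (Continuous.div (by fun_prop) (by fun_prop) fun x => pow_ne_zero _ (hρ x)))

/-- The prefactor is of order `1/ρ`. The bracket is so too, because `d ≤ ρ` and `|d² - 2x²| ≤ 2ρ²`.
Quadratic decay is needed since `J''` does not decay along the line. -/
lemma exists_norm_green_le {lam d : ℝ} (hd : 0 < d) (hlam : 0 < lam) :
    ∃ C, 0 ≤ C ∧ ∀ x, ‖green lam d x‖ ≤ C * (1 + x ^ 2)⁻¹ := by
  have hZ : 0 < Z₀ := by unfold Z₀; positivity
  set k := 2 * Real.pi / lam with hk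
  have hkpos : 0 < k := by positivity
  refine ⟨Z₀ / (2 * lam) * (d + 2 / k + 2 / (k ^ 2 * d)) * (1 + 1 / d ^ 2), by positivity,
    fun x => ?_⟩
  set ρ := √(x ^ 2 + d ^ 2) with hρ
  have hρ2 : ρ ^ 2 = x ^ 2 + d ^ 2 := Real.sq_sqrt (by positivity)
  have hρpos : 0 < ρ := Real.sqrt_pos.2 (by positivity)
  have hdρ : d ≤ ρ := Real.le_sqrt_of_sq_le (by nlinarith [sq_nonneg x])
  set B := (d ^ 2 - 2 * x ^ 2) / ρ ^ 2 with hB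
  have hB2 : |B| ≤ 2 := by
    rw [hB, abs_div, abs_of_pos (pow_pos hρpos 2), div_le_iff₀ (pow_pos hρpos 2), hρ2, abs_le]
    constructor <;> nlinarith [sq_nonneg x, sq_nonneg d]
  have hg : green lam d x = (-Complex.I * Z₀ * Complex.exp (Complex.I * (k * ρ : ℝ))) /
      (2 * lam * ρ : ℝ) * ((d ^ 2 / ρ ^ 2 : ℝ) + Complex.I / (k * ρ : ℝ) * (B : ℝ)
        - (1 / (k ^ 2 * ρ ^ 2) * B : ℝ)) := rfl
  have h1 : ‖(-Complex.I * Z₀ * Complex.exp (Complex.I * (k * ρ : ℝ))) / (2 * lam * ρ : ℝ)‖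
      = Z₀ / (2 * lam * ρ) := by
    rw [norm_div, norm_mul, norm_mul, norm_neg, Complex.norm_I, Complex.norm_real,
      mul_comm Complex.I, Complex.norm_exp_ofReal_mul_I, Complex.norm_real, Real.norm_of_nonneg hZ.le,
      Real.norm_of_nonneg (by positivity)]
    ring
  have h2 : ‖((d ^ 2 / ρ ^ 2 : ℝ) : ℂ) + Complex.I / (k * ρ : ℝ) * (B : ℝ)
        - (1 / (k ^ 2 * ρ ^ 2) * B : ℝ)‖ ≤ (d + 2 / k + 2 / (k ^ 2 * d)) / ρ := by
    refine (norm_sub_le _ _).trans ?_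
    refine (add_le_add_left (norm_add_le _ _) _).trans ?_
    rw [norm_mul, norm_div, Complex.norm_I, Complex.norm_real, Complex.norm_real,
      Complex.norm_real, Complex.norm_real, Real.norm_eq_abs, Real.norm_eq_abs, Real.norm_eq_abs,
      Real.norm_eq_abs, abs_of_nonneg (by positivity : 0 ≤ d ^ 2 / ρ ^ 2),
      abs_of_pos (by positivity : 0 < k * ρ), abs_mul,
      abs_of_nonneg (by positivity : 0 ≤ 1 / (k ^ 2 * ρ ^ 2))]
    have t1 : d ^ 2 / ρ ^ 2 ≤ d / ρ := by
      rw [div_le_div_iff₀ (by positivity) hρpos]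
      nlinarith [mul_le_mul_of_nonneg_left hdρ (by positivity : 0 ≤ d * ρ)]
    have t2 : 1 / (k * ρ) * |B| ≤ 2 / k / ρ := by
      calc 1 / (k * ρ) * |B| ≤ 1 / (k * ρ) * 2 := by gcongr
        _ = 2 / k / ρ := by field_simp
    have t3 : 1 / (k ^ 2 * ρ ^ 2) * |B| ≤ 2 / (k ^ 2 * d) / ρ := by
      calc 1 / (k ^ 2 * ρ ^ 2) * |B| ≤ 1 / (k ^ 2 * (d * ρ)) * 2 := by
            gcongr
            nlinarith
        _ = 2 / (k ^ 2 * d) / ρ := by field_simp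
    rw [add_div, add_div]
    linarith
  have h3 : 1 / ρ ^ 2 ≤ (1 + 1 / d ^ 2) * (1 + x ^ 2)⁻¹ := by
    rw [hρ2, ← div_eq_mul_inv, div_le_div_iff₀ (by positivity) (by positivity)]
    have : (1 + 1 / d ^ 2) * (x ^ 2 + d ^ 2) = x ^ 2 + d ^ 2 + x ^ 2 / d ^ 2 + 1 := by
      field_simp; ring
    rw [this]
    have : 0 ≤ x ^ 2 / d ^ 2 := by positivity
    nlinarith [sq_nonneg d]
  rw [hg, norm_mul, h1]
  calc Z₀ / (2 * lam * ρ) * _ ≤ Z₀ / (2 * lam * ρ) * ((d + 2 / k + 2 / (k ^ 2 * d)) / ρ) := by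
        gcongr
    _ = Z₀ / (2 * lam) * (d + 2 / k + 2 / (k ^ 2 * d)) * (1 / ρ ^ 2) := by field_simp
    _ ≤ Z₀ / (2 * lam) * (d + 2 / k + 2 / (k ^ 2 * d)) *
          ((1 + 1 / d ^ 2) * (1 + x ^ 2)⁻¹) := by gcongr
    _ = _ := by ring

/-- A Peetre-type inequality: translation changes the weight by a factor controlled by `t` alone. It
makes `Tame` translation invariant and bounds the kernel seen from any point `r`. -/
lemma inv_one_add_sq_add_le (u t : ℝ) :
    (1 + (u + t) ^ 2)⁻¹ ≤ 2 * (1 + t ^ 2) * (1 + u ^ 2)⁻¹ := by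
  rw [← div_eq_mul_inv, inv_eq_one_div, div_le_div_iff₀ (by positivity) (by positivity)]
  nlinarith [sq_nonneg (u + 2 * t), sq_nonneg (t * (u + t))]

end Green

/-! ### The periodic process and strict stationarity. -/

section Periodic

/-- Both intervals are fundamental domains for translation by `L`. Measurability of `f` is not
required, which suits the probability function in `strictlyStationary_stationarized`. -/
lemma setLIntegral_periodic {L : ℝ} (hL : 0 < L) {f : ℝ → ℝ≥0∞} (hf : Function.Periodic f L)
    (a τ : ℝ) : ∫⁻ θ in Set.Icc 0 L, f (θ + τ) = ∫⁻ θ in Set.Ioc a (a + L), f θ := by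
  have h1 : ∫⁻ θ in Set.Icc 0 L, f (θ + τ) = ∫⁻ θ in Set.Ioc τ (τ + L), f θ := by
    rw [setLIntegral_congr (Ioc_ae_eq_Icc (a := (0 : ℝ)) (b := L)).symm]
    have := (measurePreserving_add_right volume τ).setLIntegral_comp_preimage_emb
      (measurableEmbedding_addRight τ) f (Set.Ioc τ (τ + L))
    rwa [Set.preimage_add_const_Ioc, sub_self, add_sub_cancel_left] at this
  rw [h1]
  refine (isAddFundamentalDomain_Ioc hL τ).setLIntegral_eq (isAddFundamentalDomain_Ioc hL a) f ?_
  rintro ⟨g, hg⟩ x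
  obtain ⟨n, rfl⟩ := AddSubgroup.mem_zmultiples_iff.1 hg
  change f (n • L + x) = f x
  rw [add_comm]
  exact hf.zsmul n x

variable {Ω : Type*}

lemma floor_add_intCast_mul {L : ℝ} (hL : 0 < L) (s : ℝ) (n : ℤ) :
    ⌊(s + n * L) / L + 1 / 2⌋ = ⌊s / L + 1 / 2⌋ + n := by
  rw [← Int.floor_add_intCast]
  congr 1
  field_simp
  ring

/-- Translation by whole cells only renumbers the copies, and renumbering preserves their joint law
(`measurePreserving_shift`). -/
lemma periodicCopy_add_intCast_mul {L : ℝ} (hL : 0 < L) (J : ℝ → Ω → ℂ) (s : ℝ) (n : ℤ)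
    (ω : ℤ → Ω) :
    periodicCopy L J (s + n * L) ω = periodicCopy L J s (fun m => ω (m + n)) := by
  unfold periodicCopy
  rw [floor_add_intCast_mul hL]
  congr 1
  push_cast
  ring

variable [MeasurableSpace Ω]

lemma measurePreserving_shift (P : Measure Ω) [IsProbabilityMeasure P] (n : ℤ) :
    MeasurePreserving (fun (ω : ℤ → Ω) m => ω (m + n)) (Measure.infinitePi fun _ : ℤ => P)
      (Measure.infinitePi fun _ : ℤ => P) := by
  refine ⟨by fun_prop, ?_⟩
  have := Measure.infinitePi_map_piCongrLeft (fun _ : ℤ => P) (Equiv.subRight n)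
  conv_rhs => rw [← this]
  congr 1
  ext ω m
  have := MeasurableEquiv.piCongrLeft_apply_apply (β := fun _ : ℤ => Ω) (Equiv.subRight n) ω (m + n)
  simpa using this.symm

/-- Resampling one coordinate independently keeps the product law. This separates the copy in cell
`0` from the others, so that the latter can be fixed. -/
lemma measurePreserving_update (P : Measure Ω) [IsProbabilityMeasure P] (n : ℤ) :
    MeasurePreserving (fun p : (ℤ → Ω) × Ω => Function.update p.1 n p.2)
      ((Measure.infinitePi fun _ : ℤ => P).prod P) (Measure.infinitePi fun _ : ℤ => P) := by
  have hm : Measurable fun p : (ℤ → Ω) × Ω => Function.update p.1 n p.2 := measurable_update'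
  refine ⟨hm, Measure.eq_infinitePi _ fun s t ht => ?_⟩
  have ht' : ∀ s' : Finset ℤ, MeasurableSet (Set.pi (s' : Set ℤ) t) :=
    fun s' => MeasurableSet.pi s'.countable_toSet fun i _ => ht i
  rw [Measure.map_apply hm (ht' s)]
  by_cases hn : n ∈ s
  · have : (fun p : (ℤ → Ω) × Ω => Function.update p.1 n p.2) ⁻¹' Set.pi (s : Set ℤ) t
        = Set.pi ((s.erase n : Finset ℤ) : Set ℤ) t ×ˢ t n := by
      ext p
      simp only [Set.mem_preimage, Set.mem_pi, Finset.mem_coe, Set.mem_prod, Finset.mem_erase]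
      constructor
      · intro h
        refine ⟨fun i hi => ?_, ?_⟩
        · simpa [Function.update_of_ne hi.1] using h i hi.2
        · simpa using h n hn
      · rintro ⟨h1, h2⟩ i hi
        by_cases hin : i = n
        · subst hin; simpa using h2
        · rw [Function.update_of_ne hin]; exact h1 i ⟨hin, hi⟩
    rw [this, Measure.prod_prod, Measure.infinitePi_pi _ fun i _ => ht i, mul_comm,
      Finset.mul_prod_erase s (fun i => P (t i)) hn]
  · have : (fun p : (ℤ → Ω) × Ω => Function.update p.1 n p.2) ⁻¹' Set.pi (s : Set ℤ) t
        = Set.pi (s : Set ℤ) t ×ˢ Set.univ := by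
      ext p
      simp only [Set.mem_preimage, Set.mem_pi, Finset.mem_coe, Set.mem_prod, Set.mem_univ, and_true]
      refine forall₂_congr fun i hi => ?_
      rw [Function.update_of_ne (by rintro rfl; exact hn hi)]
    rw [this, Measure.prod_prod, Measure.infinitePi_pi _ fun i _ => ht i, measure_univ, mul_one]

lemma measurable_periodicCopy (L : ℝ) {J : ℝ → Ω → ℂ}
    (hJ : Measurable fun q : ℝ × Ω => J q.1 q.2) :
    Measurable fun q : ℝ × (ℤ → Ω) => periodicCopy L J q.1 q.2 := by
  have h1 : Measurable fun q : ℤ × (ℤ → Ω) => q.2 q.1 :=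
    measurable_from_prod_countable_right fun n => measurable_pi_apply n
  have h2 : Measurable fun q : ℝ × (ℤ → Ω) => ⌊q.1 / L + 1 / 2⌋ :=
    Int.measurable_floor.comp (by fun_prop)
  have h3 : Measurable fun q : ℝ × (ℤ → Ω) => ((⌊q.1 / L + 1 / 2⌋ : ℤ) : ℝ) :=
    (measurable_of_countable _).comp h2
  exact hJ.comp ((measurable_fst.sub (h3.mul_const L)).prodMk (h1.comp (h2.prodMk measurable_snd)))

lemma measurable_stationarized (L : ℝ) {J : ℝ → Ω → ℂ}
    (hJ : Measurable fun q : ℝ × Ω => J q.1 q.2) :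
    Measurable fun q : ℝ × ((ℤ → Ω) × ℝ) => stationarized L J q.1 q.2 :=
  (measurable_periodicCopy L hJ).comp
    (f := fun q : ℝ × ((ℤ → Ω) × ℝ) => (q.1 + q.2.2, q.2.1)) (by fun_prop)

lemma isProbabilityMeasure_uniform {L : ℝ} (hL : 0 < L) :
    IsProbabilityMeasure (ProbabilityTheory.cond volume (Set.Icc 0 L)) :=
  cond_isProbabilityMeasure_of_finite (by simp [hL]) (by simp)

lemma isProbabilityMeasure_stationarizedMeasure (P : Measure Ω) [IsProbabilityMeasure P] {L : ℝ}
    (hL : 0 < L) : IsProbabilityMeasure (stationarizedMeasure L P) := by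
  have := isProbabilityMeasure_uniform hL
  unfold stationarizedMeasure
  infer_instance

/-- The law of `(J'(s i + t))ᵢ` is `L`-periodic in `t`, and a uniform `θ` averages it over a whole
period; the average does not see `τ`. -/
theorem strictlyStationary_stationarized (P : Measure Ω) [IsProbabilityMeasure P] {L : ℝ}
    (hL : 0 < L) {J : ℝ → Ω → ℂ} (hJ : Measurable fun q : ℝ × Ω => J q.1 q.2) :
    StrictlyStationary (stationarizedMeasure L P) (stationarized L J) := by
  intro τ n s
  have := isProbabilityMeasure_uniform hL
  have hm : ∀ τ : ℝ, Measurable fun (p : (ℤ → Ω) × ℝ) (i : Fin n) =>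
      stationarized L J (s i + τ) p := fun τ =>
    measurable_pi_lambda _ fun i => (measurable_stationarized L hJ).comp measurable_prodMk_left
  have hm0 := hm 0
  simp only [add_zero] at hm0
  ext B hB
  rw [Measure.map_apply (hm τ) hB, Measure.map_apply hm0 hB]
  set f : ℝ → ℝ≥0∞ := fun t => (Measure.infinitePi fun _ : ℤ => P)
    {ω | (fun i => periodicCopy L J (s i + t) ω) ∈ B} with hf
  have hper : Function.Periodic f L := by
    intro t
    have hset : MeasurableSet {ω : ℤ → Ω | (fun i => periodicCopy L J (s i + t) ω) ∈ B} := by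
      refine measurableSet_preimage (measurable_pi_lambda _ fun i => ?_) hB
      exact (measurable_periodicCopy L hJ).comp measurable_prodMk_left
    rw [hf]
    simp only
    rw [← (measurePreserving_shift P 1).measure_preimage hset.nullMeasurableSet]
    congr 1
    ext ω
    simp only [Set.mem_ofPred_eq, Set.mem_preimage, ← periodicCopy_add_intCast_mul hL]
    simp [add_assoc]
  have key : ∀ τ : ℝ, stationarizedMeasure L P
      ((fun (p : (ℤ → Ω) × ℝ) (i : Fin n) => stationarized L J (s i + τ) p) ⁻¹' B)
      = ∫⁻ θ, f (θ + τ) ∂(ProbabilityTheory.cond volume (Set.Icc 0 L)) := by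
    intro τ
    unfold stationarizedMeasure
    rw [Measure.prod_apply_symm (hm τ hB)]
    refine lintegral_congr fun θ => ?_
    rw [hf]
    simp only
    congr 1
    ext ω
    simp only [Set.mem_preimage, Set.mem_ofPred_eq, stationarized]
    simp only [add_assoc, add_comm θ τ]
  have key0 := key 0
  simp only [add_zero] at key0
  rw [key, key0]
  have h0 := setLIntegral_periodic hL hper 0 0
  simp only [add_zero] at h0
  simp only [ProbabilityTheory.cond, lintegral_smul_measure]
  rw [setLIntegral_periodic hL hper 0 τ, h0]

end Periodic

/-! ### Fields of deterministic currents with weighted integrability. -/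

section Tame

/-- Current densities on the line that are integrable against `(1 + u²)⁻¹`. -/
structure Tame (f : ℝ → ℂ) : Prop where
  measurable : Measurable f
  integrable : Integrable fun u => (1 + u ^ 2)⁻¹ * ‖f u‖

/-- The field induced by the current density `f` on the whole line. -/
def greenConv (lam d : ℝ) (f : ℝ → ℂ) (r : ℝ) : ℂ := ∫ u, green lam d (r - u) * f u

lemma Tame.comp_add {f : ℝ → ℂ} (hf : Tame f) (t : ℝ) : Tame fun s => f (s + t) := by
  refine ⟨hf.measurable.comp (by fun_prop), ?_⟩
  have h := (hf.integrable.comp_add_right t).const_mul (2 * (1 + t ^ 2))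
  refine h.mono' ?_ (Filter.Eventually.of_forall fun u => ?_)
  · exact (Measurable.mul (by fun_prop)
      (hf.measurable.comp (by fun_prop)).norm).aestronglyMeasurable
  · rw [Real.norm_of_nonneg (by positivity), ← mul_assoc]
    gcongr
    have := inv_one_add_sq_add_le (u + t) (-t)
    rwa [neg_sq, add_neg_cancel_right] at this

lemma Tame.indicator {f : ℝ → ℂ} (hf : Tame f) {S : Set ℝ} (hS : MeasurableSet S) :
    Tame (S.indicator f) := by
  refine ⟨hf.measurable.indicator hS, hf.integrable.mono' ?_ (Filter.Eventually.of_forall fun u => ?_)⟩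
  · exact (Measurable.mul (by fun_prop) (hf.measurable.indicator hS).norm).aestronglyMeasurable
  · rw [Real.norm_of_nonneg (by positivity)]
    gcongr
    exact norm_indicator_le_norm_self f u

lemma exists_norm_green_sub_le {lam d : ℝ} (hd : 0 < d) (hlam : 0 < lam) :
    ∃ C, 0 ≤ C ∧ ∀ r u, ‖green lam d (r - u)‖ ≤ C * (1 + r ^ 2) * (1 + u ^ 2)⁻¹ := by
  obtain ⟨C, hC0, hC⟩ := exists_norm_green_le hd hlam
  refine ⟨C * 2, by positivity, fun r u => (hC _).trans ?_⟩
  have h := inv_one_add_sq_add_le u (-r)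
  have e : (r - u) ^ 2 = (u + -r) ^ 2 := by ring
  rw [e, mul_assoc, mul_assoc]
  rw [neg_sq, mul_assoc] at h
  gcongr

variable {lam d : ℝ}

lemma Tame.integrable_green_mul (hd : 0 < d) (hlam : 0 < lam) {f : ℝ → ℂ} (hf : Tame f)
    (r : ℝ) : Integrable fun u => green lam d (r - u) * f u := by
  obtain ⟨C, hC0, hC⟩ := exists_norm_green_sub_le hd hlam
  refine (hf.integrable.const_mul (C * (1 + r ^ 2))).mono' ?_ (Filter.Eventually.of_forall fun u => ?_)
  · exact (((continuous_green lam hd hlam).comp (by fun_prop)).measurable.mul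
      hf.measurable).aestronglyMeasurable
  · rw [norm_mul, ← mul_assoc]
    gcongr
    exact hC r u

lemma Tame.continuous_greenConv (hd : 0 < d) (hlam : 0 < lam) {f : ℝ → ℂ} (hf : Tame f) :
    Continuous (greenConv lam d f) := by
  obtain ⟨C, hC0, hC⟩ := exists_norm_green_sub_le hd hlam
  have hg := continuous_green lam hd hlam
  refine continuous_iff_continuousAt.2 fun r₀ => ?_
  refine continuousAt_of_dominated
    (bound := fun u => C * (1 + (|r₀| + 1) ^ 2) * ((1 + u ^ 2)⁻¹ * ‖f u‖))
    (Filter.Eventually.of_forall fun r => (hf.integrable_green_mul hd hlam r).aestronglyMeasurable)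
    ?_ (hf.integrable.const_mul _) (Filter.Eventually.of_forall fun u => ?_)
  · filter_upwards [Metric.ball_mem_nhds r₀ one_pos] with r hr
    refine Filter.Eventually.of_forall fun u => ?_
    rw [norm_mul, ← mul_assoc]
    gcongr
    refine (hC r u).trans ?_
    have h1 : |r| ≤ |r₀| + 1 := by
      have := abs_sub_abs_le_abs_sub r r₀
      rw [Metric.mem_ball, Real.dist_eq] at hr
      linarith
    have h2 : r ^ 2 ≤ (|r₀| + 1) ^ 2 := by
      rw [← sq_abs r]; gcongr
    gcongr
  · exact ((hg.comp (by fun_prop)).mul continuous_const).continuousAt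

lemma greenConv_comp_add (f : ℝ → ℂ) (t r : ℝ) :
    greenConv lam d (fun s => f (s + t)) r = greenConv lam d f (r + t) := by
  unfold greenConv
  rw [← integral_add_right_eq_self (fun u => green lam d (r + t - u) * f u) t]
  simp only [add_sub_add_right_eq_sub]

lemma Tame.greenConv_indicator_add (hd : 0 < d) (hlam : 0 < lam) {f : ℝ → ℂ} (hf : Tame f)
    {S : Set ℝ} (hS : MeasurableSet S) (r : ℝ) :
    greenConv lam d f r
      = greenConv lam d (S.indicator f) r + greenConv lam d (Sᶜ.indicator f) r := by
  unfold greenConv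
  rw [← integral_add ((hf.indicator hS).integrable_green_mul hd hlam r)
    ((hf.indicator hS.compl).integrable_green_mul hd hlam r)]
  refine integral_congr_ae (Filter.Eventually.of_forall fun u => ?_)
  simp only
  rw [← mul_add, ← Pi.add_apply, Set.indicator_self_add_compl]

variable {α β : ℝ}

lemma integrable_Lp_Icc (φ : Lp ℂ 2 (volume.restrict (Set.Icc α β))) :
    Integrable φ (volume.restrict (Set.Icc α β)) :=
  (Lp.memLp φ).integrable one_le_two

lemma integrable_star_mul_continuous (φ : Lp ℂ 2 (volume.restrict (Set.Icc α β))) {h : ℝ → ℂ}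
    (hh : Continuous h) :
    Integrable (fun r => star (φ r) * h r) (volume.restrict (Set.Icc α β)) := by
  have h1 : IntegrableOn (fun r => star (φ r)) (Set.Icc α β) :=
    (integrable_Lp_Icc φ).mono
      (continuous_star.comp_aestronglyMeasurable (integrable_Lp_Icc φ).aestronglyMeasurable)
      (Filter.Eventually.of_forall fun r => (norm_star _).le)
  exact h1.mul_continuousOn hh.continuousOn isCompact_Icc

/-- The correlation of the field of `f`, shifted by `x`, with `φ`. -/
def fieldCoeff (lam d : ℝ) (φ : Lp ℂ 2 (volume.restrict (Set.Icc α β))) (f : ℝ → ℂ) (x : ℝ) : ℂ :=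
  ∫ r in Set.Icc α β, star (φ r) * greenConv lam d f (r + x)

lemma Tame.continuous_fieldCoeff (hd : 0 < d) (hlam : 0 < lam) {f : ℝ → ℂ} (hf : Tame f)
    (φ : Lp ℂ 2 (volume.restrict (Set.Icc α β))) : Continuous (fieldCoeff lam d φ f) := by
  have hc := hf.continuous_greenConv hd hlam
  refine continuous_iff_continuousAt.2 fun x₀ => ?_
  obtain ⟨K, hK⟩ := (isCompact_Icc (a := α + x₀ - 1) (b := β + x₀ + 1)).exists_bound_of_continuousOn
    hc.continuousOn
  refine continuousAt_of_dominated (bound := fun r => ‖φ r‖ * K)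
    (Filter.Eventually.of_forall fun x =>
      (integrable_star_mul_continuous φ (hc.comp (by fun_prop))).aestronglyMeasurable)
    ?_ ((integrable_Lp_Icc φ).norm.mul_const K) (Filter.Eventually.of_forall fun r => ?_)
  · filter_upwards [Metric.ball_mem_nhds x₀ one_pos] with x hx
    filter_upwards [ae_restrict_mem measurableSet_Icc] with r hr
    rw [norm_mul, norm_star]
    gcongr
    refine hK _ ?_
    rw [Metric.mem_ball, Real.dist_eq, abs_lt] at hx
    constructor <;> linarith [hr.1, hr.2]
  · exact (continuous_const.mul (hc.comp (by fun_prop))).continuousAt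

lemma integrable_norm_mul_one_add_sq (φ : Lp ℂ 2 (volume.restrict (Set.Icc α β))) (C : ℝ) :
    Integrable (fun r => ‖φ r‖ * (C * (1 + r ^ 2))) (volume.restrict (Set.Icc α β)) := by
  have h1 : IntegrableOn (fun r => ‖φ r‖) (Set.Icc α β) := (integrable_Lp_Icc φ).norm
  have hc : Continuous fun r : ℝ => C * (1 + r ^ 2) := by fun_prop
  exact h1.mul_continuousOn hc.continuousOn isCompact_Icc

/-- The functional of the current density that gives the correlation of its field with `φ`. -/
def adjointKernel (lam d : ℝ) (φ : Lp ℂ 2 (volume.restrict (Set.Icc α β))) (s : ℝ) : ℂ :=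
  ∫ r in Set.Icc α β, star (φ r) * green lam d (r - s)

lemma stronglyMeasurable_adjointKernel (hd : 0 < d) (hlam : 0 < lam)
    (φ : Lp ℂ 2 (volume.restrict (Set.Icc α β))) :
    StronglyMeasurable (adjointKernel lam d φ) := by
  unfold adjointKernel
  refine StronglyMeasurable.integral_prod_right
    (f := fun s r => star (φ r) * green lam d (r - s)) ?_
  have hφ := (Lp.stronglyMeasurable φ).measurable
  have hg := (continuous_green lam hd hlam).measurable
  have hs : Measurable fun p : ℝ × ℝ => star (φ p.2) :=
    continuous_star.measurable.comp (hφ.comp measurable_snd)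
  exact (hs.mul (hg.comp (measurable_snd.sub measurable_fst))).stronglyMeasurable

lemma exists_norm_adjointKernel_le (hd : 0 < d) (hlam : 0 < lam)
    (φ : Lp ℂ 2 (volume.restrict (Set.Icc α β))) :
    ∃ K, 0 ≤ K ∧ ∀ s, ‖adjointKernel lam d φ s‖ ≤ K * (1 + s ^ 2)⁻¹ := by
  obtain ⟨C, hC0, hC⟩ := exists_norm_green_sub_le hd hlam
  refine ⟨∫ r in Set.Icc α β, ‖φ r‖ * (C * (1 + r ^ 2)), integral_nonneg fun r => by positivity,
    fun s => ?_⟩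
  rw [← integral_mul_const]
  refine norm_integral_le_of_norm_le ((integrable_norm_mul_one_add_sq φ C).mul_const _)
    (Filter.Eventually.of_forall fun r => ?_)
  rw [norm_mul, norm_star, mul_assoc]
  gcongr
  exact hC r s

/-- These bounds make the kernel an admissible `ψ` in `fieldInfo`. -/
lemma memLp_adjointKernel (hd : 0 < d) (hlam : 0 < lam)
    (φ : Lp ℂ 2 (volume.restrict (Set.Icc α β))) :
    MemLp (adjointKernel lam d φ) 1 volume ∧ MemLp (adjointKernel lam d φ) ∞ volume := by
  obtain ⟨K, hK0, hK⟩ := exists_norm_adjointKernel_le hd hlam φ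
  have hm := (stronglyMeasurable_adjointKernel hd hlam φ).aestronglyMeasurable (μ := volume)
  refine ⟨memLp_one_iff_integrable.2 ((integrable_inv_one_add_sq.const_mul K).mono' hm
    (Filter.Eventually.of_forall hK)), memLp_top_of_bound hm K
    (Filter.Eventually.of_forall fun s => (hK s).trans ?_)⟩
  refine mul_le_of_le_one_right hK0 (inv_le_one_of_one_le₀ ?_)
  nlinarith [sq_nonneg s]

/-- Fubini. Thus the noiseless coordinate of the field is itself a linear functional of the current.
-/
lemma Tame.integral_adjointKernel_mul (hd : 0 < d) (hlam : 0 < lam) {f : ℝ → ℂ} (hf : Tame f)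
    (φ : Lp ℂ 2 (volume.restrict (Set.Icc α β))) :
    ∫ s, adjointKernel lam d φ s * f s
      = ∫ r in Set.Icc α β, star (φ r) * greenConv lam d f r := by
  obtain ⟨C, hC0, hC⟩ := exists_norm_green_sub_le hd hlam
  have hφ := (Lp.stronglyMeasurable φ).measurable
  have hg := (continuous_green lam hd hlam).measurable
  have hs : Measurable fun p : ℝ × ℝ => star (φ p.1) :=
    continuous_star.measurable.comp (hφ.comp measurable_fst)
  have hint : Integrable (fun p : ℝ × ℝ => star (φ p.1) * (green lam d (p.1 - p.2) * f p.2))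
      ((volume.restrict (Set.Icc α β)).prod volume) := by
    refine ((integrable_norm_mul_one_add_sq φ C).mul_prod hf.integrable).mono' ?_
      (Filter.Eventually.of_forall fun p => ?_)
    · exact (hs.mul ((hg.comp (measurable_fst.sub measurable_snd)).mul
        (hf.measurable.comp measurable_snd))).aestronglyMeasurable
    · rw [norm_mul, norm_mul, norm_star]
      calc ‖φ p.1‖ * (‖green lam d (p.1 - p.2)‖ * ‖f p.2‖)
          ≤ ‖φ p.1‖ * (C * (1 + p.1 ^ 2) * (1 + p.2 ^ 2)⁻¹ * ‖f p.2‖) := by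
            gcongr
            exact hC p.1 p.2
        _ = _ := by ring
  unfold greenConv adjointKernel
  simp_rw [← integral_const_mul, ← integral_mul_const]
  simp only [mul_assoc]
  exact (integral_integral_swap hint).symm

end Tame

/-! ### Sample paths of the periodic process. -/

section Random

variable {Ω : Type*}

lemma floor_div_add_half_eq_zero {L : ℝ} (hL : 0 < L) {s : ℝ} (h1 : -(L / 2) ≤ s)
    (h2 : s < L / 2) : ⌊s / L + 1 / 2⌋ = 0 := by
  rw [Int.floor_eq_zero_iff]
  constructor
  · have : -(1 / 2) ≤ s / L := by rw [le_div_iff₀ hL]; linarith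
    linarith
  · have : s / L < 1 / 2 := by rw [div_lt_iff₀ hL]; linarith
    linarith

lemma floor_div_add_half_ne_zero {L : ℝ} (hL : 0 < L) {s : ℝ}
    (hs : s ∉ Set.Ico (-(L / 2)) (L / 2)) : ⌊s / L + 1 / 2⌋ ≠ 0 := by
  contrapose! hs
  obtain ⟨h1, h2⟩ := Int.floor_eq_zero_iff.1 hs
  have h3 : -(1 / 2) ≤ s / L := by linarith
  have h4 : s / L < 1 / 2 := by linarith
  rw [le_div_iff₀ hL] at h3
  rw [div_lt_iff₀ hL] at h4
  constructor <;> linarith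

lemma periodicCopy_update_of_notMem {L : ℝ} (hL : 0 < L) (J : ℝ → Ω → ℂ) {s : ℝ}
    (hs : s ∉ Set.Ico (-(L / 2)) (L / 2)) (ω : ℤ → Ω) (ω' : Ω) :
    periodicCopy L J s (Function.update ω 0 ω') = periodicCopy L J s ω := by
  rw [periodicCopy, periodicCopy, Function.update_of_ne (floor_div_add_half_ne_zero hL hs)]

lemma periodicCopy_of_mem {L : ℝ} (hL : 0 < L) (J : ℝ → Ω → ℂ) {s : ℝ} (h1 : -(L / 2) ≤ s)
    (h2 : s < L / 2) (ω : ℤ → Ω) : periodicCopy L J s ω = J s (ω 0) := by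
  rw [periodicCopy, floor_div_add_half_eq_zero hL h1 h2, Int.cast_zero, zero_mul, sub_zero]

variable [MeasurableSpace Ω]

/-- Almost every sample path of the periodic process is integrable against `(1 + u²)⁻¹`. -/
lemma ae_tame_periodicCopy (P : Measure Ω) [IsProbabilityMeasure P] {L : ℝ} (hL : 0 < L)
    {J : ℝ → Ω → ℂ} (hJ : Measurable fun q : ℝ × Ω => J q.1 q.2)
    (hJint : Integrable (fun q : ℝ × Ω => J q.1 q.2)
      ((volume.restrict (Set.Icc (-(L / 2)) (L / 2))).prod P)) :
    ∀ᵐ ω ∂(Measure.infinitePi fun _ : ℤ => P), Tame fun u => periodicCopy L J u ω := by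
  have hJ' := measurable_periodicCopy L hJ
  set Q := Measure.infinitePi fun _ : ℤ => P with hQ
  set w : ℝ → ℝ≥0∞ := fun u => ENNReal.ofReal ((1 + u ^ 2)⁻¹) with hw
  have hwm : Measurable w := by fun_prop
  set m : ℝ → ℝ≥0∞ := fun u => ∫⁻ ω, ‖periodicCopy L J u ω‖ₑ ∂Q with hm
  have hmm : Measurable m := Measurable.lintegral_prod_right hJ'.enorm
  have hper : Function.Periodic m L := by
    intro u
    have h := (measurePreserving_shift P 1).lintegral_comp
      (f := fun ω => ‖periodicCopy L J u ω‖ₑ) (hJ'.comp measurable_prodMk_left).enorm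
    rw [hm]
    simp only
    rw [← h]
    refine lintegral_congr fun ω => ?_
    rw [← periodicCopy_add_intCast_mul hL]
    simp
  set c : ℝ≥0∞ := ∫⁻ u in Set.Ioc (-(L / 2)) (-(L / 2) + L), m u with hc
  have hcfin : c ≠ ∞ := by
    have e : -(L / 2) + L = L / 2 := by ring
    have h1 : c = ∫⁻ u in Set.Ioo (-(L / 2)) (L / 2), ∫⁻ ω, ‖J u ω‖ₑ ∂P := by
      rw [hc, e, setLIntegral_congr Ioo_ae_eq_Ioc.symm]
      refine setLIntegral_congr_fun measurableSet_Ioo fun u hu => ?_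
      rw [hm]
      simp only
      rw [← (measurePreserving_eval_infinitePi (fun _ : ℤ => P) 0).lintegral_comp
        (f := fun ω => ‖J u ω‖ₑ) (hJ.comp measurable_prodMk_left).enorm]
      refine lintegral_congr fun ω => ?_
      rw [periodicCopy_of_mem hL J hu.1.le hu.2]
    rw [h1, setLIntegral_congr Ioo_ae_eq_Icc, ← lintegral_prod _ hJ.enorm.aemeasurable]
    exact hJint.hasFiniteIntegral.ne
  set K : ℝ≥0∞ := ENNReal.ofReal (2 * (1 + L ^ 2)) with hK
  have hwK : ∀ u, ∀ θ ∈ Set.Icc 0 L, w (u + θ) ≤ K * w u := by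
    intro u θ hθ
    rw [hw, hK, ← ENNReal.ofReal_mul (by positivity)]
    refine ENNReal.ofReal_le_ofReal ((inv_one_add_sq_add_le u θ).trans ?_)
    have : θ ^ 2 ≤ L ^ 2 := pow_le_pow_left₀ hθ.1 hθ.2 2
    gcongr
  have hwint : ∫⁻ u, w u ≠ ∞ := by
    have h := integrable_inv_one_add_sq.hasFiniteIntegral
    rw [hasFiniteIntegral_iff_ofReal (Filter.Eventually.of_forall fun u => by positivity)] at h
    exact h.ne
  -- The weighted integral is averaged over translations `θ ∈ [0, L]`. The weight costs only the
  -- factor `K`, while integrating the periodic function `m` over `θ` gives the same constant `c`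
  -- for every `u`.
  have hmain : ENNReal.ofReal L * ∫⁻ u, w u * m u ≤ K * (c * ∫⁻ u, w u) := by
    calc ENNReal.ofReal L * ∫⁻ u, w u * m u
        = ∫⁻ _ in Set.Icc 0 L, (∫⁻ u, w u * m u) := by
          rw [setLIntegral_const, Real.volume_Icc, sub_zero, mul_comm]
      _ ≤ ∫⁻ θ in Set.Icc 0 L, ∫⁻ u, K * w u * m (u + θ) := by
          refine setLIntegral_mono' measurableSet_Icc fun θ hθ => ?_
          rw [← lintegral_add_right_eq_self _ θ]
          refine lintegral_mono fun u => ?_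
          gcongr
          exact hwK u θ hθ
      _ = ∫⁻ u, ∫⁻ θ in Set.Icc 0 L, K * w u * m (u + θ) := by
          rw [lintegral_lintegral_swap]
          fun_prop
      _ = ∫⁻ u, K * w u * c := by
          refine lintegral_congr fun u => ?_
          rw [lintegral_const_mul _ (by fun_prop), hc, ← setLIntegral_periodic hL hper _ u]
          simp only [add_comm u]
      _ = K * (c * ∫⁻ u, w u) := by
          rw [lintegral_mul_const _ (by fun_prop), lintegral_const_mul _ hwm]
          ring
  have hfin : ∫⁻ u, w u * m u ≠ ∞ := by
    intro h
    rw [h, ENNReal.mul_top (ENNReal.ofReal_pos.2 hL).ne', top_le_iff] at hmain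
    exact ENNReal.mul_ne_top ENNReal.ofReal_ne_top (ENNReal.mul_ne_top hcfin hwint) hmain
  have hJ2 : Measurable fun q : (ℤ → Ω) × ℝ => w q.2 * ‖periodicCopy L J q.2 q.1‖ₑ :=
    (hwm.comp measurable_snd).mul (hJ'.comp measurable_swap).enorm
  have hfin2 : ∫⁻ ω, ∫⁻ u, w u * ‖periodicCopy L J u ω‖ₑ ∂volume ∂Q ≠ ∞ := by
    rw [lintegral_lintegral_swap hJ2.aemeasurable]
    refine ne_of_eq_of_ne (lintegral_congr fun u => ?_) hfin
    exact lintegral_const_mul _ (hJ'.comp (measurable_prodMk_left (x := u))).enorm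
  filter_upwards [ae_lt_top hJ2.lintegral_prod_right' hfin2] with ω hω
  have hmω : Measurable fun u => periodicCopy L J u ω := hJ'.comp measurable_prodMk_right
  refine ⟨hmω, (Measurable.mul (by fun_prop) hmω.norm).aestronglyMeasurable, ?_⟩
  rw [hasFiniteIntegral_iff_ofReal (Filter.Eventually.of_forall fun u => by positivity)]
  refine lt_of_eq_of_lt (lintegral_congr fun u => ?_) hω
  rw [ENNReal.ofReal_mul (by positivity), ofReal_norm]

theorem ae_integrable_green_mul_stationarized (P : Measure Ω) [IsProbabilityMeasure P]
    {L lam d : ℝ} (hL : 0 < L) (hd : 0 < d) (hlam : 0 < lam)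
    {J : ℝ → Ω → ℂ} (hJ : Measurable fun q : ℝ × Ω => J q.1 q.2)
    (hJint : Integrable (fun q : ℝ × Ω => J q.1 q.2)
      ((volume.restrict (Set.Icc (-(L / 2)) (L / 2))).prod P)) :
    ∀ᵐ p ∂(stationarizedMeasure L P), ∀ r : ℝ,
      Integrable fun s => green lam d (r - s) * stationarized L J s p := by
  have h := (Measure.quasiMeasurePreserving_fst (μ := Measure.infinitePi fun _ : ℤ => P)
    (ν := ProbabilityTheory.cond volume (Set.Icc 0 L))).ae (ae_tame_periodicCopy P hL hJ hJint)
  have := isProbabilityMeasure_uniform hL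
  filter_upwards [h] with p hp r
  exact (hp.comp_add p.2).integrable_green_mul hd hlam r

end Random

/-! ### Information carried by the field of the periodic process. -/

section RandomField

variable {Ω : Type*} {lam d α β L : ℝ}

attribute [local irreducible] fieldCoeff greenConv

lemma fieldCoeff_periodicCopy_add (hL : 0 < L) (φ : Lp ℂ 2 (volume.restrict (Set.Icc α β)))
    (J : ℝ → Ω → ℂ) (ω : ℤ → Ω) (x : ℝ) (n : ℤ) :
    fieldCoeff lam d φ (fun u => periodicCopy L J u ω) (x + n * L)
      = fieldCoeff lam d φ (fun u => periodicCopy L J u fun m => ω (m + n)) x := by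
  unfold fieldCoeff
  simp_rw [← add_assoc, ← greenConv_comp_add, periodicCopy_add_intCast_mul hL]

lemma Tame.fieldCoeff_indicator_add (hd : 0 < d) (hlam : 0 < lam) {f : ℝ → ℂ} (hf : Tame f)
    {S : Set ℝ} (hS : MeasurableSet S) (φ : Lp ℂ 2 (volume.restrict (Set.Icc α β))) (x : ℝ) :
    fieldCoeff lam d φ f x
      = fieldCoeff lam d φ (S.indicator f) x + fieldCoeff lam d φ (Sᶜ.indicator f) x := by
  have hint : ∀ T : Set ℝ, MeasurableSet T →
      Integrable (fun r => star (φ r) * greenConv lam d (T.indicator f) (r + x))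
        (volume.restrict (Set.Icc α β)) := fun T hT =>
    integrable_star_mul_continuous φ (((hf.indicator hT).continuous_greenConv hd hlam).comp
      (continuous_add_const x))
  unfold fieldCoeff
  rw [← integral_add (hint S hS) (hint Sᶜ hS.compl)]
  refine integral_congr_ae (Filter.Eventually.of_forall fun r => ?_)
  simp only
  rw [← mul_add, ← hf.greenConv_indicator_add hd hlam hS]

/-- The noiseless coordinates of the field received from the source `[-L/2, L/2]`. -/
def segmentSignal (lam d L : ℝ) {n : ℕ} (φ : Fin n → Lp ℂ 2 (volume.restrict (Set.Icc α β)))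
    (J : ℝ → Ω → ℂ) (ω : Ω) (i : Fin n) : ℂ :=
  ∫ r in Set.Icc α β, star (φ i r) * efield lam d (Set.Icc (-(L / 2)) (L / 2)) J r ω

/-- The noiseless coordinates of the field of the periodic process, shifted by `x`. -/
def periodicSignal (lam d L : ℝ) {n : ℕ} (φ : Fin n → Lp ℂ 2 (volume.restrict (Set.Icc α β)))
    (J : ℝ → Ω → ℂ) (x : ℝ) (ω : ℤ → Ω) (i : Fin n) : ℂ :=
  fieldCoeff lam d (φ i) (fun u => periodicCopy L J u ω) x

lemma segmentSignal_eq_fieldCoeff {n : ℕ} (φ : Fin n → Lp ℂ 2 (volume.restrict (Set.Icc α β)))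
    (J : ℝ → Ω → ℂ) (ω : Ω) (i : Fin n) :
    segmentSignal lam d L φ J ω i = fieldCoeff lam d (φ i)
      (fun u => (Set.Ico (-(L / 2)) (L / 2)).indicator (fun u => J u ω) u) 0 := by
  have h : ∀ r, efield lam d (Set.Icc (-(L / 2)) (L / 2)) J r ω = greenConv lam d
      (fun u => (Set.Ico (-(L / 2)) (L / 2)).indicator (fun u => J u ω) u) r := by
    intro r
    rw [efield, setIntegral_congr_set Ico_ae_eq_Icc.symm, ← integral_indicator measurableSet_Ico,
      greenConv]
    refine integral_congr_ae (Filter.Eventually.of_forall fun u => ?_)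
    by_cases hu : u ∈ Set.Ico (-(L / 2)) (L / 2) <;> simp [hu]
  simp only [segmentSignal, fieldCoeff, h, add_zero]

variable [MeasurableSpace Ω]

lemma measurable_greenConv (hd : 0 < d) (hlam : 0 < lam) {F : ℝ → Ω → ℂ}
    (hF : Measurable fun q : ℝ × Ω => F q.1 q.2) :
    Measurable fun q : ℝ × Ω => greenConv lam d (fun u => F u q.2) q.1 := by
  unfold greenConv
  refine (StronglyMeasurable.integral_prod_right
    (f := fun (q : ℝ × Ω) u => green lam d (q.1 - u) * F u q.2) ?_).measurable
  have hg := (continuous_green lam hd hlam).measurable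
  have h1 : Measurable fun p : (ℝ × Ω) × ℝ => green lam d (p.1.1 - p.2) := hg.comp (by fun_prop)
  have h2 : Measurable fun p : (ℝ × Ω) × ℝ => F p.2 p.1.2 :=
    hF.comp (f := fun p : (ℝ × Ω) × ℝ => (p.2, p.1.2)) (by fun_prop)
  exact (h1.mul h2).stronglyMeasurable

lemma measurable_fieldCoeff (hd : 0 < d) (hlam : 0 < lam)
    (φ : Lp ℂ 2 (volume.restrict (Set.Icc α β))) {F : ℝ → Ω → ℂ}
    (hF : Measurable fun q : ℝ × Ω => F q.1 q.2) :
    Measurable fun q : Ω × ℝ => fieldCoeff lam d φ (fun u => F u q.1) q.2 := by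
  unfold fieldCoeff
  refine (StronglyMeasurable.integral_prod_right
    (f := fun (q : Ω × ℝ) r => star (φ r) * greenConv lam d (fun u => F u q.1) (r + q.2))
    ?_).measurable
  have hφ := (Lp.stronglyMeasurable φ).measurable
  have h1 : Measurable fun p : (Ω × ℝ) × ℝ => star (φ p.2) :=
    continuous_star.measurable.comp (hφ.comp measurable_snd)
  have h2 : Measurable fun p : (Ω × ℝ) × ℝ =>
      greenConv lam d (fun u => F u p.1.1) (p.2 + p.1.2) :=
    (measurable_greenConv hd hlam hF).comp
      (f := fun p : (Ω × ℝ) × ℝ => (p.2 + p.1.2, p.1.1)) (by fun_prop)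
  exact (h1.mul h2).stronglyMeasurable

lemma measurable_segmentSignal (hd : 0 < d) (hlam : 0 < lam) {n : ℕ}
    (φ : Fin n → Lp ℂ 2 (volume.restrict (Set.Icc α β))) {J : ℝ → Ω → ℂ}
    (hJ : Measurable fun q : ℝ × Ω => J q.1 q.2) : Measurable (segmentSignal lam d L φ J) := by
  refine measurable_pi_lambda _ fun i => ?_
  simp_rw [segmentSignal_eq_fieldCoeff]
  have hF : Measurable fun q : ℝ × Ω =>
      (Set.Ico (-(L / 2)) (L / 2)).indicator (fun u => J u q.2) q.1 := by
    have := hJ.indicator (measurableSet_Ico (a := -(L / 2)) (b := L / 2) |>.preimage measurable_fst)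
    exact this
  exact (measurable_fieldCoeff hd hlam (φ i)
    (F := fun u ω => (Set.Ico (-(L / 2)) (L / 2)).indicator (fun u => J u ω) u) hF).comp
      measurable_prodMk_right

lemma measurable_periodicSignal (hd : 0 < d) (hlam : 0 < lam) {n : ℕ}
    (φ : Fin n → Lp ℂ 2 (volume.restrict (Set.Icc α β))) {J : ℝ → Ω → ℂ}
    (hJ : Measurable fun q : ℝ × Ω => J q.1 q.2) :
    Measurable fun q : (ℤ → Ω) × ℝ => periodicSignal lam d L φ J q.2 q.1 :=
  measurable_pi_lambda _ fun i => measurable_fieldCoeff hd hlam (φ i) (measurable_periodicCopy L hJ)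

lemma measurable_periodicSignal_right (hd : 0 < d) (hlam : 0 < lam) {n : ℕ}
    (φ : Fin n → Lp ℂ 2 (volume.restrict (Set.Icc α β))) {J : ℝ → Ω → ℂ}
    (hJ : Measurable fun q : ℝ × Ω => J q.1 q.2) (x : ℝ) :
    Measurable (periodicSignal lam d L φ J x) :=
  (measurable_periodicSignal hd hlam φ hJ).comp measurable_prodMk_right

variable {P : Measure Ω} [IsProbabilityMeasure P]

/-- A shift by whole cells renumbers the i.i.d. copies, so the law of the signal is unchanged. -/
lemma gaussInfo_periodicSignal_add (hL : 0 < L) (hd : 0 < d) (hlam : 0 < lam) {v : ℝ≥0}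
    (hv : 0 < v) {n : ℕ} (φ : Fin n → Lp ℂ 2 (volume.restrict (Set.Icc α β))) {J : ℝ → Ω → ℂ}
    (hJ : Measurable fun q : ℝ × Ω => J q.1 q.2) (x : ℝ) (k : ℤ) :
    gaussInfo (Measure.infinitePi fun _ : ℤ => P) v (periodicSignal lam d L φ J (x + k * L))
      = gaussInfo (Measure.infinitePi fun _ : ℤ => P) v (periodicSignal lam d L φ J x) := by
  rw [← gaussInfo_comp (measurePreserving_shift P k) hv
    (measurable_periodicSignal_right hd hlam φ hJ x).aemeasurable]
  congr 1
  ext ω i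
  exact fieldCoeff_periodicCopy_add hL (φ i) J ω x k

/-- Almost every path is `Tame`, so its coordinates depend continuously on the shift; semicontinuity
of the information does the rest. -/
lemma eventually_lt_gaussInfo_periodicSignal (hL : 0 < L) (hd : 0 < d) (hlam : 0 < lam) {v : ℝ≥0}
    (hv : 0 < v) {n : ℕ} (φ : Fin n → Lp ℂ 2 (volume.restrict (Set.Icc α β))) {J : ℝ → Ω → ℂ}
    (hJ : Measurable fun q : ℝ × Ω => J q.1 q.2)
    (hJint : Integrable (fun q : ℝ × Ω => J q.1 q.2)
      ((volume.restrict (Set.Icc (-(L / 2)) (L / 2))).prod P)) {c : ℝ≥0∞} {x₀ : ℝ}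
    (hc : c < gaussInfo (Measure.infinitePi fun _ : ℤ => P) v (periodicSignal lam d L φ J x₀)) :
    ∀ᶠ x in nhds x₀,
      c < gaussInfo (Measure.infinitePi fun _ : ℤ => P) v (periodicSignal lam d L φ J x) := by
  refine eventually_lt_gaussInfo hv
    (fun x => (measurable_periodicSignal_right hd hlam φ hJ x).aemeasurable)
    (measurable_periodicSignal_right hd hlam φ hJ x₀).aemeasurable ?_ hc
  filter_upwards [ae_tame_periodicCopy P hL hJ hJint] with ω hω
  exact tendsto_pi_nhds.2 fun i => (hω.continuous_fieldCoeff hd hlam (φ i)).tendsto x₀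

/-- The currents in the other cells do not decrease the information, since they are known. -/
lemma gaussInfo_segmentSignal_le (hL : 0 < L) (hd : 0 < d) (hlam : 0 < lam) {v : ℝ≥0}
    (hv : 0 < v) {n : ℕ} (φ : Fin n → Lp ℂ 2 (volume.restrict (Set.Icc α β))) {J : ℝ → Ω → ℂ}
    (hJ : Measurable fun q : ℝ × Ω => J q.1 q.2)
    (hJint : Integrable (fun q : ℝ × Ω => J q.1 q.2)
      ((volume.restrict (Set.Icc (-(L / 2)) (L / 2))).prod P)) :
    gaussInfo P v (segmentSignal lam d L φ J)
      ≤ gaussInfo (Measure.infinitePi fun _ : ℤ => P) v (periodicSignal lam d L φ J 0) := by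
  have hV := measurable_periodicSignal_right (L := L) hd hlam φ hJ 0
  have hU := measurePreserving_update P 0
  have hE := measurable_segmentSignal (L := L) hd hlam φ hJ
  rw [← gaussInfo_comp hU hv hV.aemeasurable]
  refine le_gaussInfo_prod hv (hV.comp hU.measurable).aemeasurable ?_
  have htame := hU.quasiMeasurePreserving.ae (ae_tame_periodicCopy P hL hJ hJint)
  filter_upwards [Measure.ae_ae_of_ae_prod htame] with ω hω
  -- The contribution of all cells other than cell `0`. It depends on `ω` only, hence is constant
  -- once these currents are fixed.
  set G : Fin n → ℂ := fun i => fieldCoeff lam d (φ i)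
    ((Set.Ico (-(L / 2)) (L / 2))ᶜ.indicator fun u => periodicCopy L J u ω) 0 with hG
  rw [← gaussInfo_add_const hv hE.aemeasurable G]
  refine (gaussInfo_congr ?_).le
  filter_upwards [hω] with ω' hω'
  ext i
  change segmentSignal lam d L φ J ω' i + G i
    = fieldCoeff lam d (φ i) (fun u => periodicCopy L J u (Function.update ω 0 ω')) 0
  rw [hω'.fieldCoeff_indicator_add hd hlam
    (measurableSet_Ico (a := -(L / 2)) (b := L / 2)), segmentSignal_eq_fieldCoeff]
  refine congrArg₂ (· + ·) (congrArg (fieldCoeff lam d (φ i) · 0) ?_)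
    (congrArg (fieldCoeff lam d (φ i) · 0) ?_)
  · ext u
    by_cases hu : u ∈ Set.Ico (-(L / 2)) (L / 2)
    · rw [Set.indicator_of_mem hu, Set.indicator_of_mem hu, periodicCopy_of_mem hL J hu.1 hu.2,
        Function.update_self]
    · rw [Set.indicator_of_notMem hu, Set.indicator_of_notMem hu]
  · ext u
    by_cases hu : u ∈ Set.Ico (-(L / 2)) (L / 2)
    · rw [Set.indicator_of_notMem (by simpa using hu), Set.indicator_of_notMem (by simpa using hu)]
    · rw [Set.indicator_of_mem hu, Set.indicator_of_mem hu, periodicCopy_update_of_notMem hL J hu]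

end RandomField

/-! ### Translated test functions and orthonormal expansions. -/

section Translation

variable {α β α' β' : ℝ}

lemma setIntegral_indicator_comp_sub {c : ℝ} (h1 : α' ≤ α + c) (h2 : β + c ≤ β') (H : ℝ → ℂ) :
    ∫ r in Set.Icc α' β', (Set.Icc α β).indicator H (r - c) = ∫ r in Set.Icc α β, H r := by
  rw [← integral_indicator measurableSet_Icc, ← integral_indicator measurableSet_Icc,
    ← integral_sub_right_eq_self ((Set.Icc α β).indicator H) c]
  congr 1
  ext r
  by_cases hr : r ∈ Set.Icc α' β'
  · rw [Set.indicator_of_mem hr]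
  · rw [Set.indicator_of_notMem hr, Set.indicator_of_notMem]
    exact fun h => hr ⟨by linarith [h.1], by linarith [h.2]⟩

/-- Translation of a square-integrable function on a segment into a larger segment. -/
lemma exists_translate (φ : Lp ℂ 2 (volume.restrict (Set.Icc α β))) (c : ℝ) :
    ∃ φ' : Lp ℂ 2 (volume.restrict (Set.Icc α' β')),
      φ' =ᵐ[volume.restrict (Set.Icc α' β')] fun r => (Set.Icc α β).indicator φ (r - c) := by
  have h1 : MemLp ((Set.Icc α β).indicator φ) 2 volume :=
    (memLp_indicator_iff_restrict measurableSet_Icc).2 (Lp.memLp φ)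
  have h2 : MemLp (fun r => (Set.Icc α β).indicator φ (r - c)) 2
      (volume.restrict (Set.Icc α' β')) :=
    (h1.comp_measurePreserving (measurePreserving_sub_right volume c)).restrict _
  exact ⟨h2.toLp _, h2.coeFn_toLp⟩

/-- A finite family of vectors lies in the span of a finite orthonormal family. -/
lemma exists_orthonormal_expansion {H ι : Type*} [NormedAddCommGroup H] [InnerProductSpace ℂ H]
    [Finite ι] (x : ι → H) :
    ∃ (N : ℕ) (e : Fin N → H), Orthonormal ℂ e ∧ ∀ i, x i = ∑ l, inner ℂ (e l) (x i) • e l := by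
  let S := Submodule.span ℂ (Set.range x)
  have : FiniteDimensional ℂ S := FiniteDimensional.span_of_finite ℂ (Set.finite_range x)
  let b := stdOrthonormalBasis ℂ S
  refine ⟨Module.finrank ℂ S, fun l => (b l : H), b.orthonormal.comp_linearIsometry S.subtypeₗᵢ,
    fun i => ?_⟩
  have h := b.sum_repr' ⟨x i, Submodule.subset_span ⟨i, rfl⟩⟩
  have h' := congrArg (Subtype.val) h
  simpa using h'.symm

/-- Since each `x i` lies in the span of `e`, Parseval turns the product into the Gram matrix of
`x`. -/
lemma mul_conjTranspose_of_expansion {H : Type*} [NormedAddCommGroup H] [InnerProductSpace ℂ H]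
    {N n : ℕ} {e : Fin N → H} {x : Fin n → H} (hx : Orthonormal ℂ x)
    (h : ∀ i, x i = ∑ l, inner ℂ (e l) (x i) • e l) :
    (Matrix.of fun i l => (inner ℂ (x i) (e l) : ℂ)) *
      (Matrix.of fun i l => (inner ℂ (x i) (e l) : ℂ)).conjTranspose = 1 := by
  ext i j
  rw [Matrix.mul_apply, Matrix.one_apply, ← orthonormal_iff_ite.1 hx i j]
  conv_rhs => rw [h j]
  rw [inner_sum]
  refine Finset.sum_congr rfl fun l _ => ?_
  rw [inner_smul_right, Matrix.conjTranspose_apply, Matrix.of_apply, Matrix.of_apply]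
  rw [mul_comm]
  congr 1
  exact inner_conj_symm _ _

lemma setIntegral_star_expansion {N : ℕ} {e : Fin N → Lp ℂ 2 (volume.restrict (Set.Icc α β))}
    {x : Lp ℂ 2 (volume.restrict (Set.Icc α β))} (hx : x = ∑ l, inner ℂ (e l) x • e l)
    {h : ℝ → ℂ} (hh : Continuous h) :
    ∫ r in Set.Icc α β, star (x r) * h r
      = ∑ l, inner ℂ x (e l) * ∫ r in Set.Icc α β, star (e l r) * h r := by
  simp_rw [← integral_const_mul]
  rw [← integral_finsetSum _ fun l _ => (integrable_star_mul_continuous (e l) hh).const_mul _]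
  refine integral_congr_ae ?_
  have h1 : ∀ᵐ r ∂(volume.restrict (Set.Icc α β)), x r = ∑ l, inner ℂ (e l) x * e l r := by
    have h2 := Lp.coeFn_fun_finsetSum Finset.univ fun l => (inner ℂ (e l) x : ℂ) • e l
    rw [← hx] at h2
    have h3 : ∀ᵐ r ∂(volume.restrict (Set.Icc α β)), ∀ l,
        ((inner ℂ (e l) x : ℂ) • e l : Lp ℂ 2 (volume.restrict (Set.Icc α β))) r
          = inner ℂ (e l) x * e l r := by
      rw [ae_all_iff]
      intro l
      exact Lp.coeFn_smul _ _
    filter_upwards [h2, h3] with r hr2 hr3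
    rw [hr2]
    exact Finset.sum_congr rfl fun l _ => hr3 l
  filter_upwards [h1] with r hr
  rw [hr, star_sum, Finset.sum_mul]
  refine Finset.sum_congr rfl fun l _ => ?_
  rw [star_mul', mul_assoc]
  congr 1
  exact inner_conj_symm _ _

/-- The hypotheses `h1` and `h2` keep the translated segment inside the larger one, so nothing is
cut off. -/
lemma inner_translate {φ χ : Lp ℂ 2 (volume.restrict (Set.Icc α β))}
    {φ' χ' : Lp ℂ 2 (volume.restrict (Set.Icc α' β'))} {c : ℝ} (h1 : α' ≤ α + c) (h2 : β + c ≤ β')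
    (hφ : φ' =ᵐ[volume.restrict (Set.Icc α' β')] fun r => (Set.Icc α β).indicator φ (r - c))
    (hχ : χ' =ᵐ[volume.restrict (Set.Icc α' β')] fun r => (Set.Icc α β).indicator χ (r - c)) :
    (inner ℂ φ' χ' : ℂ) = inner ℂ φ χ := by
  rw [L2.inner_def, L2.inner_def, ← setIntegral_indicator_comp_sub h1 h2]
  refine integral_congr_ae ?_
  filter_upwards [hφ, hχ] with r hr1 hr2
  rw [hr1, hr2]
  by_cases hr : r - c ∈ Set.Icc α β
  · rw [Set.indicator_of_mem hr, Set.indicator_of_mem hr, Set.indicator_of_mem hr]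
  · rw [Set.indicator_of_notMem hr, Set.indicator_of_notMem hr, Set.indicator_of_notMem hr,
      inner_zero_left]

lemma setIntegral_star_translate_mul {φ : Lp ℂ 2 (volume.restrict (Set.Icc α β))}
    {φ' : Lp ℂ 2 (volume.restrict (Set.Icc α' β'))} {c : ℝ} (h1 : α' ≤ α + c) (h2 : β + c ≤ β')
    (hφ : φ' =ᵐ[volume.restrict (Set.Icc α' β')] fun r => (Set.Icc α β).indicator φ (r - c))
    (h : ℝ → ℂ) :
    ∫ r in Set.Icc α' β', star (φ' r) * h r = ∫ r in Set.Icc α β, star (φ r) * h (r + c) := by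
  rw [← setIntegral_indicator_comp_sub h1 h2]
  refine integral_congr_ae ?_
  filter_upwards [hφ] with r hr1
  rw [hr1]
  by_cases hr : r - c ∈ Set.Icc α β
  · rw [Set.indicator_of_mem hr, Set.indicator_of_mem hr, sub_add_cancel]
  · rw [Set.indicator_of_notMem hr, Set.indicator_of_notMem hr, star_zero, zero_mul]

end Translation

/-! ### Discretizing the shift and concluding. -/

section Main

variable {Ω : Type*} {lam d α β L : ℝ}

lemma efield_stationarized (J : ℝ → Ω → ℂ) (r : ℝ) (p : (ℤ → Ω) × ℝ) :
    efield lam d Set.univ (stationarized L J) r p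
      = greenConv lam d (fun u => periodicCopy L J u p.1) (r + p.2) := by
  rw [← greenConv_comp_add, efield, setIntegral_univ, greenConv]
  rfl

attribute [local irreducible] fieldCoeff greenConv

/-- The coordinates of the shifted periodic field along an orthonormal family that spans translates
of `φ` determine the coordinates along these translates. -/
lemma mulVec_periodicSignal {α' β' : ℝ} (hd : 0 < d) (hlam : 0 < lam) {N n : ℕ}
    {φ : Fin n → Lp ℂ 2 (volume.restrict (Set.Icc α β))}
    {φ' : Fin n → Lp ℂ 2 (volume.restrict (Set.Icc α' β'))} {c : ℝ} (h1 : α' ≤ α + c)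
    (h2 : β + c ≤ β')
    (hφ : ∀ i, φ' i =ᵐ[volume.restrict (Set.Icc α' β')]
      fun r => (Set.Icc α β).indicator (φ i) (r - c))
    {e : Fin N → Lp ℂ 2 (volume.restrict (Set.Icc α' β'))}
    (he : ∀ i, φ' i = ∑ l, inner ℂ (e l) (φ' i) • e l) {J : ℝ → Ω → ℂ} {ω : ℤ → Ω}
    (hω : Tame fun u => periodicCopy L J u ω) (θ : ℝ) :
    (Matrix.of fun i l => (inner ℂ (φ' i) (e l) : ℂ)).mulVec (periodicSignal lam d L e J θ ω)
      = periodicSignal lam d L φ J (c + θ) ω := by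
  ext i
  have hc := (hω.continuous_greenConv hd hlam).comp (continuous_add_const θ)
  have e1 := setIntegral_star_expansion (he i) hc
  have e2 := setIntegral_star_translate_mul h1 h2 (hφ i)
    (greenConv lam d (fun u => periodicCopy L J u ω) ∘ fun r => r + θ)
  rw [e1] at e2
  simp only [Function.comp_apply] at e2
  unfold periodicSignal fieldCoeff
  simp only [Matrix.mulVec, dotProduct, Matrix.of_apply]
  rw [e2]
  simp only [add_assoc]

variable [MeasurableSpace Ω] {P : Measure Ω} [IsProbabilityMeasure P]

/-- The information about the field of `J''` is at most the mutual information between `J''` and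
the received field. -/
lemma gaussInfo_stationarized_le_fieldInfo (hL : 0 < L) (hd : 0 < d) (hlam : 0 < lam) {v : ℝ≥0}
    (hv : 0 < v) {n : ℕ} {φ : Fin n → Lp ℂ 2 (volume.restrict (Set.Icc α β))}
    (hφ : Orthonormal ℂ φ) {J : ℝ → Ω → ℂ}
    (hJ : Measurable fun q : ℝ × Ω => J q.1 q.2)
    (hJint : Integrable (fun q : ℝ × Ω => J q.1 q.2)
      ((volume.restrict (Set.Icc (-(L / 2)) (L / 2))).prod P)) :
    gaussInfo (stationarizedMeasure L P) v (fun p => periodicSignal lam d L φ J p.2 p.1)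
      ≤ fieldInfo (stationarizedMeasure L P) lam d v (stationarized L J) Set.univ
        (Set.Icc α β) := by
  have := isProbabilityMeasure_stationarizedMeasure P hL
  have := isProbabilityMeasure_uniform hL
  have hm := measurable_periodicSignal (L := L) hd hlam φ hJ
  have hψ : ∀ j, MemLp (adjointKernel lam d (φ j)) 1 (volume.restrict Set.univ) ∧
      MemLp (adjointKernel lam d (φ j)) ∞ (volume.restrict Set.univ) := by
    intro j
    rw [Measure.restrict_univ]
    exact memLp_adjointKernel hd hlam (φ j)
  have htame : ∀ᵐ p ∂(stationarizedMeasure L P), Tame fun u => periodicCopy L J u p.1 :=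
    (Measure.quasiMeasurePreserving_fst (μ := Measure.infinitePi fun _ : ℤ => P)
      (ν := ProbabilityTheory.cond volume (Set.Icc 0 L))).ae (ae_tame_periodicCopy P hL hJ hJint)
  have hE : ∀ p i, ∫ r in Set.Icc α β, star (φ i r) *
      efield lam d Set.univ (stationarized L J) r p = periodicSignal lam d L φ J p.2 p.1 i := by
    intro p i
    simp only [efield_stationarized, periodicSignal, fieldCoeff]
  have hX : ∀ᵐ p ∂(stationarizedMeasure L P), (fun i => ∫ s in Set.univ,
      adjointKernel lam d (φ i) s * stationarized L J s p)
        = periodicSignal lam d L φ J p.2 p.1 := by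
    filter_upwards [htame] with p hp
    ext i
    rw [setIntegral_univ, ← hE]
    have h := (hp.comp_add p.2).integral_adjointKernel_mul hd hlam (φ i)
    refine h.trans (integral_congr_ae (Filter.Eventually.of_forall fun r => ?_))
    simp only
    rw [efield_stationarized, ← greenConv_comp_add]
  rw [← mutualInfo_self_eq_gaussInfo hv hm.aemeasurable]
  refine le_trans (le_of_eq (mutualInfo_congr ?_ ?_))
    (le_iSup_of_le n <| le_iSup_of_le (fun j => adjointKernel lam d (φ j)) <|
      le_iSup_of_le hψ <| le_iSup_of_le n <| le_iSup_of_le φ <| le_iSup_of_le hφ le_rfl)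
  · exact ((Measure.quasiMeasurePreserving_fst (ν := whiteNoise v n)).ae hX).mono
      fun p hp => hp.symm
  · refine Filter.Eventually.of_forall fun p => ?_
    ext i
    simp only [Pi.add_apply, hE]

/-- A shift of the destination by at most its slack brings the phase of the source to `0`, up to
`L / K`. -/
lemma exists_shift (hL : 0 < L) (t : ℝ) (K k : ℕ) :
    ∃ (c : ℝ) (z : ℤ), t ≤ c ∧ c ≤ t + L ∧ ∀ θ, c + θ = (θ - k * (L / K)) + z * L := by
  -- The witness is the representative of `-k L / K` modulo `L` in `[t, t + L)`.
  refine ⟨toIcoMod hL t (-(k * (L / K))), -toIcoDiv hL t (-(k * (L / K))),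
    left_le_toIcoMod hL _ _, (toIcoMod_lt_right hL _ _).le, fun θ => ?_⟩
  rw [toIcoMod]
  push_cast
  rw [zsmul_eq_mul]
  ring

/-- Whatever `θ` is, one of finitely many translates of `φ` sees the process almost in phase, and
one orthonormal family fixed in advance resolves all these translates. -/
theorem fieldInfo_le_fieldInfo_stationarized (hL : 0 < L) (hd : 0 < d) (hlam : 0 < lam) {v : ℝ≥0}
    (hv : 0 < v) {J : ℝ → Ω → ℂ} (hJ : Measurable fun q : ℝ × Ω => J q.1 q.2)
    (hJint : Integrable (fun q : ℝ × Ω => J q.1 q.2)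
      ((volume.restrict (Set.Icc (-(L / 2)) (L / 2))).prod P)) (a b : ℝ) :
    fieldInfo P lam d v J (Set.Icc (-(L / 2)) (L / 2)) (Set.Icc b (b + L)) ≤
      fieldInfo (stationarizedMeasure L P) lam d v (stationarized L J) Set.univ
        (Set.Icc a (a + 2 * L)) := by
  have huniform := isProbabilityMeasure_uniform hL
  have hstat := isProbabilityMeasure_stationarizedMeasure P hL
  refine iSup_le fun m => iSup_le fun ψ => iSup_le fun hψ => iSup_le fun n => iSup_le fun φ =>
    iSup_le fun hφ => ?_
  have hX : AEMeasurable (fun ω (j : Fin m) => ∫ s in Set.Icc (-(L / 2)) (L / 2), ψ j s * J s ω)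
      P := by
    refine aemeasurable_pi_lambda _ fun j => AEStronglyMeasurable.aemeasurable ?_
    refine AEStronglyMeasurable.integral_prod_right'
      (f := fun q : Ω × ℝ => ψ j q.2 * J q.2 q.1) ?_
    exact (((hψ j).1.aestronglyMeasurable).comp_snd).mul
      (hJ.comp measurable_swap).aestronglyMeasurable
  refine (mutualInfo_le_gaussInfo (E := segmentSignal lam d L φ J)
    (measurable_segmentSignal hd hlam φ hJ).aemeasurable hX).trans ?_
  refine (gaussInfo_segmentSignal_le hL hd hlam hv φ hJ hJint).trans ?_
  -- Semicontinuity only gives bounds strictly below the value at `0`; this reduction also covers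
  -- infinite information.
  refine le_of_forall_lt_imp_le_of_dense fun c hc => ?_
  obtain ⟨δ, hδ, hball⟩ := Metric.eventually_nhds_iff.1
    (eventually_lt_gaussInfo_periodicSignal hL hd hlam hv φ hJ hJint hc)
  obtain ⟨K, hK⟩ := exists_nat_gt (L / δ)
  have hKpos : (0 : ℝ) < K := (div_pos hL hδ).trans hK
  have hKδ : L / K < δ := by
    rw [div_lt_iff₀ hδ] at hK
    rw [div_lt_iff₀ hKpos]
    linarith
  -- With `sh k` in `[a - b, a - b + L]`, the translate of `[b, b + L]` stays inside `[a, a + 2L]`;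
  -- this is where the length `2L` is needed.
  choose sh z hsh1 hsh2 hsh using
    fun k : Fin (K + 1) => exists_shift hL (a - b) K k
  have hl : ∀ k, a ≤ b + sh k := fun k => by linarith [hsh1 k]
  have hr : ∀ k, b + L + sh k ≤ a + 2 * L := fun k => by linarith [hsh2 k]
  choose φ' hφ' using fun (q : Fin (K + 1) × Fin n) =>
    exists_translate (α' := a) (β' := a + 2 * L) (φ q.2) (sh q.1)
  -- A single family for all `k`: the receiver's test functions cannot depend on `θ`.
  obtain ⟨N, e, he, hexp⟩ := exists_orthonormal_expansion φ'
  refine le_trans ?_ (gaussInfo_stationarized_le_fieldInfo hL hd hlam hv he hJ hJint)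
  have hm := measurable_periodicSignal (L := L) hd hlam e hJ
  -- `le_gaussInfo_prod` fixes the first factor, so `θ` is moved there.
  have hswap : MeasurePreserving Prod.swap
      ((ProbabilityTheory.cond volume (Set.Icc 0 L)).prod (Measure.infinitePi fun _ : ℤ => P))
      (stationarizedMeasure L P) := Measure.measurePreserving_swap
  rw [← gaussInfo_comp hswap hv hm.aemeasurable]
  refine le_gaussInfo_prod hv (hm.comp measurable_swap).aemeasurable ?_
  filter_upwards [ae_cond_mem measurableSet_Icc] with θ hθ
  have hθK : ⌊θ * K / L⌋₊ < K + 1 := by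
    rw [Nat.floor_lt (by have := hθ.1; positivity), div_lt_iff₀ hL]
    push_cast
    nlinarith [hθ.2]
  -- The grid point `k L / K` just below `θ`; the value `θ = L` gives `k = K`, hence `K + 1`
  -- translates.
  set k : Fin (K + 1) := ⟨⌊θ * K / L⌋₊, hθK⟩ with hk
  have hdist : dist (θ - (k : ℕ) * (L / K)) 0 < δ := by
    have h1 : (⌊θ * K / L⌋₊ : ℝ) ≤ θ * K / L := Nat.floor_le (by have := hθ.1; positivity)
    have h2 : θ * K / L < ⌊θ * K / L⌋₊ + 1 := Nat.lt_floor_add_one _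
    have e1 : θ = θ * K / L * (L / K) := by field_simp
    have hLK : 0 < L / K := by positivity
    rw [Real.dist_eq, sub_zero, abs_of_nonneg]
    · nlinarith
    · nlinarith
  have hA := mul_conjTranspose_of_expansion (e := e) (x := fun i => φ' (k, i))
    (by
      rw [orthonormal_iff_ite] at hφ ⊢
      intro i j
      rw [inner_translate (hl k) (hr k) (hφ' (k, i)) (hφ' (k, j)), hφ i j])
    (fun i => hexp (k, i))
  have hUm : Measurable (periodicSignal lam d L e J θ) :=
    measurable_periodicSignal_right hd hlam e hJ θ
  have hA2 := gaussInfo_mulVec_le (P := Measure.infinitePi fun _ : ℤ => P) (v := v)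
    hUm.aemeasurable _ hA
  refine le_trans ?_ hA2
  have hA3 : (fun ω => (Matrix.of fun i l => (inner ℂ (φ' (k, i)) (e l) : ℂ)).mulVec
      (periodicSignal lam d L e J θ ω)) =ᵐ[Measure.infinitePi fun _ : ℤ => P]
        periodicSignal lam d L φ J (sh k + θ) := by
    filter_upwards [ae_tame_periodicCopy P hL hJ hJint] with ω hω
    exact mulVec_periodicSignal hd hlam (hl k) (hr k) (fun i => hφ' (k, i))
      (fun i => hexp (k, i)) hω θ
  rw [gaussInfo_congr hA3, hsh k θ, gaussInfo_periodicSignal_add hL hd hlam hv φ hJ]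
  exact (hball hdist).le

end Main

end LinearAntenna

end

theorem theorem2 {Ω : Type*} [MeasurableSpace Ω] (P : Measure Ω) [IsProbabilityMeasure P]
    (L lam d : ℝ) (hL : 0 < L) (hlam : 0 < lam) (hd : 0 < d) (v : ℝ≥0) (hv : 0 < v)
    (J : ℝ → Ω → ℂ) (hJ : Measurable fun q : ℝ × Ω => J q.1 q.2)
    (hJint : Integrable (fun q : ℝ × Ω => J q.1 q.2)
      ((volume.restrict (Set.Icc (-(L / 2)) (L / 2))).prod P)) :
    LinearAntenna.StrictlyStationary (LinearAntenna.stationarizedMeasure L P)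
        (LinearAntenna.stationarized L J) ∧
      (∀ᵐ p ∂(LinearAntenna.stationarizedMeasure L P), ∀ r : ℝ,
        Integrable fun s => LinearAntenna.green lam d (r - s) * LinearAntenna.stationarized L J s p) ∧
      ∀ a b : ℝ,
        LinearAntenna.fieldInfo P lam d v J
            (Set.Icc (-(L / 2)) (L / 2)) (Set.Icc b (b + L)) ≤
          LinearAntenna.fieldInfo (LinearAntenna.stationarizedMeasure L P) lam d v
            (LinearAntenna.stationarized L J) Set.univ (Set.Icc a (a + 2 * L)) :=
  ⟨LinearAntenna.strictlyStationary_stationarized P hL hJ,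
    LinearAntenna.ae_integrable_green_mul_stationarized P hL hd hlam hJ hJint,
    LinearAntenna.fieldInfo_le_fieldInfo_stationarized hL hd hlam hv hJ hJint⟩
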